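/- All digraphs are finite and oriented: they have no loops and at most one of the directed edges $(u,v)$, $(v,u)$ for any two vertices $u,v$. A digraph $\vec H$ with $|H|$ vertices is called impartial if there is an $n\ge |H|$ such that all tournaments on $n$ vertices contain the same number of copies of $\vec H$, that is, of (not necessarily induced) subgraphs isomorphic to $\vec H$. It is weakly connected if it is non-empty and its underlying undirected graph is connected. The recursively bridge-mirrored digraphs are those obtained, up to isomorphism, by the following recursive construction: the digraph with one vertex and no edges is recursively bridge-mirrored; and if $\vec T$ is recursively bridge-mirrored and $r$ is any vertex of $\vec T$, then the digraph formed by two disjoint copies of $\vec T$ together with one new directed edge from the copy of $r$ in one of them to the copy of $r$ in the other is recursively bridge-mirrored. Proposition 5.1. Every weakly connected impartial digraph is recursively bridge-mirrored. -/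

import Mathlib

universe u

namespace Digraph

variable {V W : Type*}

/-- A digraph is an oriented graph if it is obtained by choosing one orientation of every edge of a
simple graph: it has no loops and no pair of antiparallel edges. -/
def IsOriented (G : Digraph V) : Prop :=
  ∀ u v : V, G.Adj u v → ¬ G.Adj v u

/-- A tournament has no loops and, for any two distinct vertices `u` and `v`, exactly one of the
edges `(u, v)` and `(v, u)`. -/
def IsTournament (K : Digraph V) : Prop :=
  (∀ v : V, ¬ K.Adj v v) ∧ ∀ u v : V, u ≠ v → (K.Adj u v ↔ ¬ K.Adj v u)

/-- A digraph is weakly connected if its underlying undirected graph is connected (and hence has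
at least one vertex). -/
def WeaklyConnected (G : Digraph V) : Prop :=
  G.toSimpleGraphInclusive.Connected

/-- A (not necessarily induced, not necessarily spanning) subgraph of a digraph: a set of vertices
together with a set of edges between them. -/
@[ext]
structure Subgraph (K : Digraph W) where
  /-- the vertices of the subgraph -/
  verts : Set W
  /-- the edges of the subgraph -/
  Adj : W → W → Prop
  adj_sub : ∀ {u v : W}, Adj u v → K.Adj u v
  left_mem : ∀ {u v : W}, Adj u v → u ∈ verts
  right_mem : ∀ {u v : W}, Adj u v → v ∈ verts

/-- A subgraph, seen as a digraph on its own set of vertices. -/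
def Subgraph.coe {K : Digraph W} (S : K.Subgraph) : Digraph S.verts where
  Adj u v := S.Adj u v

/-- A finite digraph has finitely many subgraphs. -/
instance Subgraph.instFinite [Finite W] (K : Digraph W) : Finite K.Subgraph :=
  Finite.of_injective (β := Set W × (W → W → Prop)) (fun S => (S.verts, S.Adj)) <| by
    intro S S' h
    exact Subgraph.ext (congrArg Prod.fst h) (congrArg Prod.snd h)

/-- The number of (unlabeled) copies of `H` in `K`: the number of subgraphs of `K` that are
isomorphic to `H`. -/
noncomputable def copyCount (H : Digraph V) (K : Digraph W) : ℕ :=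
  Set.ncard {S : K.Subgraph | Nonempty (H.Adj ≃r S.coe.Adj)}

/-- `H` is impartial if for some `n ≥ |H|` all tournaments on `n` vertices contain the same number
of copies of `H`. -/
def IsImpartial [Fintype V] (H : Digraph V) : Prop :=
  ∃ n : ℕ, Fintype.card V ≤ n ∧
    ∀ K K' : Digraph (Fin n), K.IsTournament → K'.IsTournament →
      H.copyCount K = H.copyCount K'

/-- Two disjoint copies of `T`, rooted at `r`, together with one new edge, directed from the root of
the first copy to the root of the second. -/
def mirrorDouble (T : Digraph V) (r : V) : Digraph (V ⊕ V) where
  Adj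
    | Sum.inl u, Sum.inl v => T.Adj u v
    | Sum.inr u, Sum.inr v => T.Adj u v
    | Sum.inl u, Sum.inr v => u = r ∧ v = r
    | Sum.inr _, Sum.inl _ => False

/-- The recursively bridge-mirrored digraphs: the smallest class of digraphs that contains the
one-vertex digraph without edges, is closed under doubling a member at an arbitrary root, and
is closed under isomorphism. -/
inductive RecursivelyBridgeMirrored : {V : Type u} → Digraph V → Prop
  | single : RecursivelyBridgeMirrored (⊥ : Digraph PUnit.{u + 1})
  | double {V : Type u} (T : Digraph V) (r : V) :
      RecursivelyBridgeMirrored T → RecursivelyBridgeMirrored (T.mirrorDouble r)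
  | iso {V W : Type u} (T : Digraph V) (T' : Digraph W) :
      RecursivelyBridgeMirrored T → Nonempty (T.Adj ≃r T'.Adj) → RecursivelyBridgeMirrored T'

end Digraph

/-! ### Rooted trees coded by Matula numbers -/

/-! On a tournament with sign matrix `x`, the product over the arcs `uv` of `1 + x (φ u) (φ v)` is a
fixed power of two if the injection `φ` is a homomorphism, and `0` otherwise. Impartiality makes the
sum over `φ` constant; being affine in each entry, it is constant on all antisymmetric matrices.
Summing over blow-ups gives `IsImpartial.exists_pow_mul_eq`: up to a power of `∑ w`, homomorphism
polynomials into weighted antisymmetric kernels are those of a digraph without arcs. For the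
transitive tournament this forces `2 ^ arcCount` to divide `|V|!`, so there are fewer than `|V|`
arcs and the digraph is an oriented tree.

For a tree, expand the product over the arcs into subforests. A forest contributes a sign times the
densities of its components. A density changes sign when the root moves along an edge, so it
vanishes for trees with an automorphism that flips an edge. The densities of the other trees, one
for each class under rerooting, are algebraically independent (`eq_zero_of_aeval_density`). Hence
the expansion is trivial already with indeterminates for trees, and stays trivial when one tree `N`
is sent to `X`, the single vertex to `1` and all others to `0` (`testTotal_eq_one_of_universal`).

Modulo two the signs disappear. Testing the tree against itself shows that it flips an edge. It thus
consists of two halves `A`, `B` of the same shape, its polynomial is the square of that of `A`, and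
`A` is trivial again; by repetition `A` is rigid and its size is a power of two
(`TrivialModTwo.rigid`). It remains to compare the directions in `A` and `B`. Modulo four, reversing
an edge is a change of sign plus twice the effect of cutting it, which yields a parity condition on
the edges where `A` and `B` differ (`SameShape.exists_sum_eq_two_mul`). Rigidity isolates one term
of that sum, so no edge differs (`diff_eq_nil`). Then `A = B`, and `A` inherits the hypothesis over
`ℤ`. -/

namespace RootedCode

/-- The code of the rooted tree whose root has a single child, at which the tree with code `n`
is planted: the `n`-th prime. -/
noncomputable def plant (n : ℕ+) : ℕ+ :=
  ⟨Nat.nth Nat.Prime (n - 1), (Nat.prime_nth_prime _).pos⟩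

lemma plant_prime (n : ℕ+) : (plant n : ℕ).Prime := Nat.prime_nth_prime _

lemma plant_injective : Function.Injective plant := by
  intro a b h
  have h1 : Nat.nth Nat.Prime (a - 1) = Nat.nth Nat.Prime (b - 1) := congrArg PNat.val h
  have h2 := Nat.nth_injective Nat.infinite_setOfPred_prime h1
  have ha := a.pos
  have hb := b.pos
  apply PNat.eq
  omega

lemma lt_plant (n : ℕ+) : n < plant n := by
  have h := Nat.add_two_le_nth_prime (n - 1)
  have hn := n.pos
  rw [← PNat.coe_lt_coe]
  change (n : ℕ) < Nat.nth Nat.Prime (n - 1)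
  omega

/-- The index of a prime, as a code. -/
noncomputable def index (p : ℕ) : ℕ+ := ⟨Nat.count Nat.Prime p + 1, Nat.succ_pos _⟩

lemma plant_index {p : ℕ} (hp : p.Prime) : (plant (index p) : ℕ) = p := by
  change Nat.nth Nat.Prime (Nat.count Nat.Prime p + 1 - 1) = p
  rw [Nat.add_sub_cancel, Nat.nth_count hp]

lemma index_plant (n : ℕ+) : index (plant n) = n :=
  plant_injective (PNat.eq (plant_index (plant_prime n)))

lemma plant_dvd_plant {a b : ℕ+} : plant a ∣ plant b ↔ a = b := by
  rw [PNat.dvd_iff, Nat.prime_dvd_prime_iff_eq (plant_prime a) (plant_prime b), PNat.coe_inj,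
    plant_injective.eq_iff]

lemma plant_dvd_mul {a b c : ℕ+} : plant a ∣ b * c ↔ plant a ∣ b ∨ plant a ∣ c := by
  simp only [PNat.dvd_iff, PNat.mul_coe, (plant_prime a).dvd_mul]

lemma not_plant_dvd_one (a : ℕ+) : ¬ plant a ∣ 1 := by
  rw [PNat.dvd_iff]; exact (plant_prime a).not_dvd_one

lemma not_plant_dvd_self (a : ℕ+) : ¬ plant a ∣ a := fun h =>
  absurd (PNat.le_of_dvd h) (not_le.2 (lt_plant a))

lemma eq_mul_plant {a n : ℕ+} (h : plant a ∣ n) : ∃ q, n = q * plant a := by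
  obtain ⟨q, hq⟩ := h
  exact ⟨q, by rw [hq, mul_comm]⟩

/-- Every code is that of a single vertex, or has a child. -/
lemma eq_one_or (n : ℕ+) : n = 1 ∨ ∃ q y, n = q * plant y := by
  by_cases h : n = 1
  · exact Or.inl h
  · obtain ⟨p, hp, hpn⟩ := PNat.exists_prime_and_dvd h
    have : plant (index p) = p := PNat.eq (plant_index hp)
    obtain ⟨q, hq⟩ := eq_mul_plant (this ▸ hpn)
    exact Or.inr ⟨q, index p, hq⟩

lemma lt_mul_plant_left (q y : ℕ+) : q < q * plant y := by
  have h1 := (plant_prime y).two_le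
  have h2 := q.pos
  rw [← PNat.coe_lt_coe, PNat.mul_coe]
  nlinarith

lemma lt_mul_plant_right (q y : ℕ+) : y < q * plant y := by
  have h1 := PNat.coe_lt_coe _ _ |>.2 (lt_plant y)
  have h2 := q.pos
  rw [← PNat.coe_lt_coe, PNat.mul_coe]
  nlinarith

/-- Induction over codes: a code is `1` or is obtained by planting a code in another one. -/
lemma induction_plant {motive : ℕ+ → Prop} (one : motive 1)
    (mul : ∀ q y, motive q → motive y → motive (q * plant y)) (n : ℕ+) : motive n := by
  induction n using PNat.strongInductionOn with
  | _ n ih =>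
    rcases eq_one_or n with rfl | ⟨q, y, rfl⟩
    · exact one
    · exact mul q y (ih q (lt_mul_plant_left q y)) (ih y (lt_mul_plant_right q y))

section lift
variable {M : Type*} [CommMonoid M] (L : M → M)

/-- Auxiliary function for `lift`. -/
noncomputable def liftAux (n : ℕ) : M :=
  (n.primeFactorsList.attach.map fun p => L (liftAux (index p.1))).prod
termination_by n
decreasing_by
  have hp := Nat.prime_of_mem_primeFactorsList p.2
  have h1 := PNat.coe_lt_coe _ _ |>.2 (lt_plant (index p.1))
  rw [plant_index hp] at h1
  exact lt_of_lt_of_le h1 (Nat.le_of_mem_primeFactorsList p.2)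

lemma liftAux_eq (n : ℕ) :
    liftAux L n = (n.primeFactorsList.map fun p => L (liftAux L (index p))).prod := by
  rw [liftAux]
  congr 1
  exact List.attach_map_val (f := fun p => L (liftAux L (index p)))

/-- Codes form the free commutative monoid with an endofunction: every endofunction `L` of a
commutative monoid gives a homomorphism that carries `plant` to `L`. -/
noncomputable def lift : ℕ+ →* M where
  toFun n := liftAux L n
  map_one' := by rw [liftAux_eq]; simp
  map_mul' a b := by
    rw [PNat.mul_coe, liftAux_eq L (a * b), liftAux_eq L a, liftAux_eq L b, ← List.prod_append,
      ← List.map_append]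
    exact ((Nat.perm_primeFactorsList_mul a.ne_zero b.ne_zero).map _).prod_eq

lemma lift_plant (n : ℕ+) : lift L (plant n) = L (lift L n) := by
  change liftAux L _ = L (liftAux L n)
  rw [liftAux_eq, Nat.primeFactorsList_prime (plant_prime n)]
  simp [index_plant]

end lift

/-- The number of vertices of the tree with a given code. -/
noncomputable def size (n : ℕ+) : ℕ :=
  -- The lift counts edges: joining at the root adds, planting adds one edge. The final `+ 1` is the
  -- root.
  (lift (M := Multiplicative ℕ) (fun k => Multiplicative.ofAdd (k.toAdd + 1)) n).toAdd + 1

@[simp] lemma size_one : size 1 = 1 := by simp [size]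

lemma size_mul (a b : ℕ+) : size (a * b) + 1 = size a + size b := by
  simp only [size, map_mul, toAdd_mul]; omega

lemma size_plant (a : ℕ+) : size (plant a) = size a + 1 := by
  simp [size, lift_plant]

lemma size_pos (a : ℕ+) : 0 < size a := Nat.succ_pos _

@[simp] lemma size_mul_plant (a b : ℕ+) : size (a * plant b) = size a + size b := by
  have h := size_mul a (plant b)
  rw [size_plant] at h; omega

lemma size_eq_one {n : ℕ+} : size n = 1 ↔ n = 1 := by
  refine ⟨fun h => ?_, fun h => by simp [h]⟩
  rcases eq_one_or n with rfl | ⟨q, y, rfl⟩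
  · rfl
  · have := size_pos q; have := size_pos y; rw [size_mul_plant] at h; omega

lemma size_lt_of_plant_dvd {a n : ℕ+} (h : plant a ∣ n) : size a < size n := by
  obtain ⟨q, rfl⟩ := eq_mul_plant h
  have := size_pos q
  rw [size_mul_plant]; omega

/-- If two different children are planted, each of them is a child of the rest. -/
lemma exchange {q y q' y' : ℕ+} (h : q * plant y = q' * plant y') (hne : y ≠ y') :
    ∃ k, q = k * plant y' ∧ q' = k * plant y := by
  have h1 : plant y ∣ q' * plant y' := ⟨q, by rw [← h, mul_comm]⟩
  rcases plant_dvd_mul.1 h1 with h2 | h2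
  · obtain ⟨k, rfl⟩ := eq_mul_plant h2
    refine ⟨k, ?_, rfl⟩
    have : q * plant y = (k * plant y') * plant y := by rw [h]; ac_rfl
    exact mul_right_cancel this
  · exact absurd (plant_dvd_plant.1 h2) hne

lemma mul_plant_inj_left {q y y' : ℕ+} : q * plant y = q * plant y' ↔ y = y' := by
  rw [mul_left_cancel_iff, plant_injective.eq_iff]

/-- A code is rigid if no two siblings anywhere in the tree carry the same branch. -/
inductive Rigid : ℕ+ → Prop
  | one : Rigid 1
  | mul {q y : ℕ+} : Rigid q → Rigid y → ¬ plant y ∣ q → Rigid (q * plant y)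

/-- The derivation of `Rigid` may have attached another child last. In that case `exchange` provides
a common rest, to which the induction applies. -/
lemma Rigid.of_mul_plant {q y : ℕ+} (h : Rigid (q * plant y)) :
    Rigid q ∧ Rigid y ∧ ¬ plant y ∣ q := by
  induction q using PNat.strongInductionOn generalizing y with
  | _ q ih =>
    generalize hn : q * plant y = n at h
    cases h with
    | one =>
      have := lt_mul_plant_left q y
      rw [hn] at this
      exact absurd this (not_lt.2 one_le)
    | @mul q' y' hq hy hd =>
      by_cases he : y = y'
      · subst he
        have := mul_right_cancel hn
        subst this
        exact ⟨hq, hy, hd⟩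
      · obtain ⟨k, rfl, rfl⟩ := exchange hn he
        obtain ⟨hk, hy', hdk⟩ := ih k (lt_mul_plant_left k y') hq
        refine ⟨Rigid.mul hk hy fun h => hd (h.mul_right _), hy', fun h => ?_⟩
        rcases plant_dvd_mul.1 h with h | h
        · exact hdk h
        · exact he (plant_dvd_plant.1 h)

end RootedCode

namespace RootedCode

/-! ### Canonical roots -/

/-- A child is dominant in `n` if it has at least half of the vertices. -/
lemma dominant_unique {q y q' y' : ℕ+} (h : q * plant y = q' * plant y')
    (hy : size q ≤ size y) (hy' : size q' ≤ size y') : q = q' ∧ y = y' := by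
  by_cases he : y = y'
  · subst he
    exact ⟨mul_right_cancel h, rfl⟩
  · obtain ⟨k, rfl, rfl⟩ := exchange h he
    have := size_pos k
    simp only [size_mul_plant] at hy hy'
    omega

open Classical in
/-- Signed code of the preferred root of a tree with a centroid or a balanced edge. -/
noncomputable def balancedForm (n : ℕ+) : ℤ × ℕ+ :=
  if h : ∃ r : ℕ+ × ℕ+, n = r.1 * plant r.2 ∧ size r.1 = size r.2 then
    -- Across a balanced edge the root goes to the half with the larger code. Equal halves allow no
    -- choice, so both signs would occur; hence `0`.
    if h.choose.1 = h.choose.2 then (0, n)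
    else if h.choose.2 < h.choose.1 then (1, n)
    else (-1, h.choose.2 * plant h.choose.1)
  else (1, n)

lemma balancedForm_of_size_eq {q y : ℕ+} (h : size q = size y) :
    balancedForm (q * plant y) =
      if q = y then (0, q * plant y) else if y < q then (1, q * plant y)
      else (-1, y * plant q) := by
  have hex : ∃ r : ℕ+ × ℕ+, q * plant y = r.1 * plant r.2 ∧ size r.1 = size r.2 :=
    ⟨(q, y), rfl, h⟩
  obtain ⟨h1, h2⟩ := dominant_unique hex.choose_spec.1 h.le hex.choose_spec.2.le
  rw [balancedForm, dif_pos hex, ← h1, ← h2]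

lemma balancedForm_of_forall {n : ℕ+} (h : ∀ q y, n = q * plant y → size q ≠ size y) :
    balancedForm n = (1, n) := by
  rw [balancedForm, dif_neg]
  rintro ⟨r, hr, hs⟩
  exact h _ _ hr hs

/-- Negate the sign of a signed code. -/
def negForm (r : ℤ × ℕ+) : ℤ × ℕ+ := (-r.1, r.2)

open Classical in
/-- Descend from the root of `x * k` along the children of `x` that contain more than half of the
vertices, changing the sign at each step. -/
noncomputable def descend (x k : ℕ+) : ℤ × ℕ+ :=
  if h : ∃ r : ℕ+ × ℕ+, x = r.1 * plant r.2 ∧ size (r.1 * k) < size r.2 then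
    -- The old rest, with everything accumulated in `k`, becomes a branch at the new root.
    negForm (descend h.choose.2 (plant (h.choose.1 * k)))
  else balancedForm (x * k)
termination_by x
decreasing_by
  conv_rhs => rw [h.choose_spec.1]
  exact lt_mul_plant_right _ _

lemma size_le_mul (q k : ℕ+) : size q ≤ size (q * k) := by
  have h1 := size_mul q k
  have h2 := size_pos k
  omega

lemma descend_of_lt {q y k : ℕ+} (h : size (q * k) < size y) :
    descend (q * plant y) k = negForm (descend y (plant (q * k))) := by
  have hex : ∃ r : ℕ+ × ℕ+, q * plant y = r.1 * plant r.2 ∧ size (r.1 * k) < size r.2 :=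
    ⟨(q, y), rfl, h⟩
  obtain ⟨h1, h2⟩ := dominant_unique hex.choose_spec.1 ((size_le_mul q k).trans h.le)
    ((size_le_mul _ k).trans hex.choose_spec.2.le)
  rw [descend, dif_pos hex, ← h1, ← h2]

lemma descend_of_forall {x k : ℕ+} (h : ∀ q y, x = q * plant y → size y ≤ size (q * k)) :
    descend x k = balancedForm (x * k) := by
  rw [descend, dif_neg]
  rintro ⟨r, hr, hs⟩
  exact absurd (h _ _ hr) (not_le.2 hs)

/-- The canonical form of a rooted tree: the code of the tree rooted at its centroid, with the sign
of the distance to it, or with sign `0` if the tree has an automorphism that flips an edge. -/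
noncomputable def canonicalForm (n : ℕ+) : ℤ × ℕ+ := descend n 1

/-- The descent never enters a branch that is at most as large as the rest, so it does not matter
whether this branch is kept aside in the second argument or belongs to the tree. This allows a
descent to be restarted after each step. -/
lemma descend_plant {x b : ℕ+} (h : size b ≤ size x) :
    descend x (plant b) = canonicalForm (x * plant b) := by
  by_cases hx : ∃ q y, x = q * plant y ∧ size (q * plant b) < size y
  · obtain ⟨q, y, rfl, hs⟩ := hx
    rw [descend_of_lt hs, canonicalForm, mul_right_comm, descend_of_lt (by rwa [mul_one]), mul_one]
  · push Not at hx
    rw [descend_of_forall hx, canonicalForm, descend_of_forall, mul_one]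
    intro q y he
    rw [mul_one]
    by_cases hb : b = y
    · subst hb
      rw [mul_right_cancel he] at h
      exact h
    · obtain ⟨k, rfl, rfl⟩ := exchange he hb
      exact hx _ _ rfl

lemma canonicalForm_of_lt {q y : ℕ+} (h : size q < size y) :
    canonicalForm (q * plant y) = negForm (canonicalForm (y * plant q)) := by
  rw [← descend_plant h.le, canonicalForm, descend_of_lt (by rwa [mul_one]), mul_one]

lemma canonicalForm_of_forall {n : ℕ+} (h : ∀ q y, n = q * plant y → size y ≤ size q) :
    canonicalForm n = balancedForm n := by
  rw [canonicalForm, descend_of_forall, mul_one]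
  simpa using h

lemma canonicalForm_of_size_eq {q y : ℕ+} (h : size q = size y) :
    canonicalForm (q * plant y) = balancedForm (q * plant y) := by
  apply canonicalForm_of_forall
  intro q' y' he
  by_contra! hlt
  obtain ⟨rfl, rfl⟩ := dominant_unique he h.le hlt.le
  omega

/-- Moving the root along an edge changes the sign of the canonical form. -/
lemma canonicalForm_swap (a b : ℕ+) :
    canonicalForm (b * plant a) = negForm (canonicalForm (a * plant b)) := by
  rcases lt_trichotomy (size a) (size b) with h | h | h
  · rw [canonicalForm_of_lt h]; simp [negForm]
  · rw [canonicalForm_of_size_eq h, canonicalForm_of_size_eq h.symm, balancedForm_of_size_eq h,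
      balancedForm_of_size_eq h.symm]
    rcases lt_trichotomy a b with h' | h' | h'
    · simp [h'.ne, h'.ne', h', not_lt.2 h'.le, negForm]
    · simp [h', negForm]
    · simp [h'.ne, h'.ne', h', not_lt.2 h'.le, negForm]
  · exact canonicalForm_of_lt h

lemma canonicalForm_mul_plant_self (a : ℕ+) : canonicalForm (a * plant a) = (0, a * plant a) := by
  rw [canonicalForm_of_size_eq rfl, balancedForm_of_size_eq rfl, if_pos rfl]

/-- Rerooting: `m` is obtained from `n` by moving the root along edges. -/
inductive Reroot : ℕ+ → ℕ+ → Prop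
  | refl (n : ℕ+) : Reroot n n
  | step (a b n : ℕ+) : Reroot (b * plant a) n → Reroot (a * plant b) n

/-- Every code either has a dominant child, or two equally large parts, or neither. -/
lemma dominant_cases (n : ℕ+) :
    (∃ q y, n = q * plant y ∧ size q < size y) ∨ (∃ q y, n = q * plant y ∧ size q = size y) ∨
      ∀ q y, n = q * plant y → size y < size q := by
  by_cases h : ∃ q y, n = q * plant y ∧ size q ≤ size y
  · obtain ⟨q, y, h1, h2⟩ := h
    rcases h2.lt_or_eq with h3 | h3
    · exact Or.inl ⟨q, y, h1, h3⟩
    · exact Or.inr (Or.inl ⟨q, y, h1, h3⟩)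
  · push Not at h
    exact Or.inr (Or.inr h)

/-- Induction that moves the root towards the centroid. -/
lemma centroid_induction {motive : ℕ+ → Prop}
    (light : ∀ n, (∀ q y, n = q * plant y → size y < size q) → motive n)
    (balanced : ∀ q y, size q = size y → motive (q * plant y))
    (step : ∀ q y, size q < size y → motive (y * plant q) → motive (q * plant y)) (n : ℕ+) :
    motive n := by
  -- After a step the part left behind is a branch not larger than the rest, so the next step goes
  -- into a child of `x`, and `x` decreases.
  have key : ∀ x b, size b ≤ size x → motive (x * plant b) := by
    intro x
    induction x using PNat.strongInductionOn with
    | _ x ih =>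
      intro b hb
      rcases dominant_cases (x * plant b) with ⟨q, y, he, h⟩ | ⟨q, y, he, h⟩ | h
      · have hby : b ≠ y := by
          rintro rfl
          rw [mul_right_cancel he] at hb
          omega
        obtain ⟨k, rfl, rfl⟩ := exchange he hby
        rw [he]
        exact step _ _ h (ih y (lt_mul_plant_right k y) _ h.le)
      · rw [he]; exact balanced _ _ h
      · exact light _ h
  rcases dominant_cases n with ⟨q, y, rfl, h⟩ | ⟨q, y, rfl, h⟩ | h
  · exact step _ _ h (key _ _ h.le)
  · exact balanced _ _ h
  · exact light _ h

lemma canonicalForm_of_light {n : ℕ+} (h : ∀ q y, n = q * plant y → size y < size q) :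
    canonicalForm n = (1, n) := by
  rw [canonicalForm_of_forall fun q y he => (h q y he).le,
    balancedForm_of_forall fun q y he => (h q y he).ne']

lemma size_canonicalForm (n : ℕ+) : size (canonicalForm n).2 = size n := by
  induction n using centroid_induction with
  | light n h => rw [canonicalForm_of_light h]
  | balanced q y h =>
    rw [canonicalForm_of_size_eq h, balancedForm_of_size_eq h]
    split_ifs <;> simp [add_comm]
  | step q y h ih =>
    rw [canonicalForm_of_lt h, negForm, ih, size_mul_plant, size_mul_plant, add_comm]

lemma canonicalForm_sign (n : ℕ+) :
    (canonicalForm n).1 = 0 ∨ (canonicalForm n).1 = 1 ∨ (canonicalForm n).1 = -1 := by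
  induction n using centroid_induction with
  | light n h => rw [canonicalForm_of_light h]; simp
  | balanced q y h =>
    rw [canonicalForm_of_size_eq h, balancedForm_of_size_eq h]
    split_ifs <;> simp
  | step q y h ih =>
    rw [canonicalForm_of_lt h, negForm]
    rcases ih with ih | ih | ih <;> simp [ih]

/-- A root produced by the descent is already in its preferred position. This is what places the
form in `Canonical` later. -/
lemma canonicalForm_canonicalForm {n : ℕ+} (h0 : (canonicalForm n).1 ≠ 0) :
    canonicalForm (canonicalForm n).2 = (1, (canonicalForm n).2) := by
  induction n using centroid_induction with
  | light n h => rw [canonicalForm_of_light h, canonicalForm_of_light h]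
  | balanced q y h =>
    rw [canonicalForm_of_size_eq h, balancedForm_of_size_eq h] at h0 ⊢
    split_ifs at h0 ⊢ with h1 h2
    · exact absurd rfl h0
    · simp [canonicalForm_of_size_eq h, balancedForm_of_size_eq h, h1, h2]
    · have h3 : q < y := lt_of_le_of_ne (not_lt.1 h2) h1
      simp [canonicalForm_of_size_eq h.symm, balancedForm_of_size_eq h.symm, h3.ne', h3]
  | step q y h ih =>
    rw [canonicalForm_of_lt h, negForm] at h0 ⊢
    exact ih (by simpa using h0)

/-- A tree whose canonical form has sign `0` consists of two equal halves. -/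
lemma exists_reroot_of_sign_eq_zero {n : ℕ+} (h0 : (canonicalForm n).1 = 0) :
    ∃ a, Reroot n (a * plant a) ∧ (Rigid a → Rigid n) := by
  induction n using centroid_induction with
  | light n h => rw [canonicalForm_of_light h] at h0; simp at h0
  | balanced q y h =>
    rw [canonicalForm_of_size_eq h, balancedForm_of_size_eq h] at h0
    split_ifs at h0 with h1 h2
    · subst h1
      exact ⟨q, Reroot.refl _, fun hq => hq.mul hq (not_plant_dvd_self q)⟩
    · simp at h0
    · simp at h0
  | step q y h ih =>
    rw [canonicalForm_of_lt h, negForm] at h0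
    obtain ⟨a, ha, hr⟩ := ih (by simpa using h0)
    refine ⟨a, Reroot.step _ _ _ ha, fun h' => ?_⟩
    obtain ⟨hy, hq, -⟩ := (hr h').of_mul_plant
    -- Rigidity survives the move because `y` is larger than `q` and cannot be a child of it.
    exact hq.mul hy fun hd => absurd (size_lt_of_plant_dvd hd) h.not_gt

lemma Reroot.size_eq {m n : ℕ+} (h : Reroot m n) : size m = size n := by
  induction h with
  | refl => rfl
  | step a b n _ ih => rw [← ih, size_mul_plant, size_mul_plant, add_comm]

/-- A rooted tree with a small branch at the root is determined, among the trees with a branch of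
the same size there, by its unrooted form. -/
lemma branch_unique {x b b' : ℕ+} (hb : size b < size x) (hs : size b = size b')
    (h : ((canonicalForm (x * plant b)).1 = 0 ∧ (canonicalForm (x * plant b')).1 = 0) ∨
      ((canonicalForm (x * plant b)).1 ≠ 0 ∧ (canonicalForm (x * plant b')).1 ≠ 0 ∧
        (canonicalForm (x * plant b)).2 = (canonicalForm (x * plant b')).2)) : b = b' := by
  induction x using PNat.strongInductionOn generalizing b b' with
  | _ x ih =>
    -- A child with at least half of the vertices cannot be the small branch, so that branch lies in
    -- the rest `q`.
    have other : ∀ {b q y}, size b < size x → x * plant b = q * plant y → size q ≤ size y →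
        ∃ k, x = k * plant y ∧ q = k * plant b := by
      intro b q y hb he hq
      refine exchange he ?_
      rintro rfl
      rw [mul_right_cancel he] at hb
      omega
    have hb' := hs ▸ hb
    rcases dominant_cases (x * plant b) with ⟨q, y, he, hlt⟩ | ⟨q, y, he, heq⟩ | hl
    · obtain ⟨k, rfl, rfl⟩ := other hb he hlt.le
      have hlt' : size (k * plant b') < size y := by
        rw [size_mul_plant] at hlt ⊢; omega
      rw [mul_right_comm k (plant y) (plant b), mul_right_comm k (plant y) (plant b'), canonicalForm_of_lt hlt,
        canonicalForm_of_lt hlt'] at h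
      simp only [negForm, neg_eq_zero, ne_eq] at h
      exact mul_plant_inj_left.1 (ih y (lt_mul_plant_right k y) hlt
        (by rw [size_mul_plant, size_mul_plant, hs]) h)
    · obtain ⟨k, rfl, rfl⟩ := other hb he heq.le
      have heq' : size (k * plant b') = size y := by
        rw [size_mul_plant] at heq ⊢; omega
      rw [mul_right_comm k (plant y) (plant b), mul_right_comm k (plant y) (plant b'), canonicalForm_of_size_eq heq,
        canonicalForm_of_size_eq heq', balancedForm_of_size_eq heq,
        balancedForm_of_size_eq heq'] at h
      apply mul_plant_inj_left (q := k).1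
      -- Opposite tie-breaks cannot give the same code: `y` would be a child of itself, or `u = y`.
      have hne : ∀ u v : ℕ+, u ≠ y → u * plant y ≠ y * plant v := by
        intro u v hu he
        have h1 : plant y ∣ y * plant v := ⟨u, by rw [← he, mul_comm]⟩
        rcases plant_dvd_mul.1 h1 with h2 | h2
        · exact not_plant_dvd_self y h2
        · rw [← plant_dvd_plant.1 h2, mul_comm] at he
          exact hu (mul_left_cancel (a := plant y) (by rw [mul_comm y] at he; exact he))
      generalize k * plant b = u at *
      generalize k * plant b' = v at *
      clear ih other
      by_cases hu : u = y <;> by_cases hv : v = y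
      · rw [hu, hv]
      · rw [if_pos hu, if_neg hv] at h
        rcases h with ⟨-, h⟩ | ⟨h, -⟩
        · split_ifs at h <;> simp at h
        · exact absurd rfl h
      · rw [if_neg hu, if_pos hv] at h
        rcases h with ⟨h, -⟩ | ⟨-, h, -⟩
        · split_ifs at h <;> simp at h
        · exact absurd rfl h
      · rw [if_neg hu, if_neg hv] at h
        rcases h with ⟨h, -⟩ | ⟨-, -, h⟩
        · split_ifs at h <;> simp at h
        · by_cases hyu : y < u <;> by_cases hyv : y < v <;> simp only [hyu, hyv, if_true, if_false] at h
          · exact mul_right_cancel h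
          · exact absurd h (hne _ _ hu)
          · exact absurd h.symm (hne _ _ hv)
          · exact mul_plant_inj_left.1 h
    · have hl' : ∀ q y, x * plant b' = q * plant y → size y < size q := by
        intro q y he
        by_contra! hq
        obtain ⟨k, rfl, rfl⟩ := other hb' he hq
        have := hl (k * plant b) y (by ac_rfl)
        rw [size_mul_plant] at hq this
        omega
      rw [canonicalForm_of_light hl, canonicalForm_of_light hl'] at h
      rcases h with ⟨h, -⟩ | ⟨-, -, h⟩
      · exact absurd h one_ne_zero
      · exact mul_plant_inj_left.1 h

end RootedCode

open RootedCode

/-! ### Signed trees -/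

/-- Rooted trees with signed edges: `att s A B` hangs the root of `B` below the root of `A`. The
sign `1` stands for an edge directed away from the root. -/
inductive SignedTree : Type
  | pt : SignedTree
  | att (s : ℤˣ) (A B : SignedTree) : SignedTree

namespace SignedTree

/-- The code of the underlying rooted tree. -/
noncomputable def code : SignedTree → ℕ+
  | pt => 1
  | att _ A B => code A * plant (code B)

/-- Isomorphism of rooted signed trees. -/
inductive RootEquiv : SignedTree → SignedTree → Prop
  | refl (A) : RootEquiv A A
  | trans {A B C} : RootEquiv A B → RootEquiv B C → RootEquiv A C
  | comm (s s' A B C) : RootEquiv (att s (att s' A B) C) (att s' (att s A C) B)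
  | congr {A A' B B'} (s) : RootEquiv A A' → RootEquiv B B' → RootEquiv (att s A B) (att s A' B')

/-- Isomorphism of unrooted signed trees. -/
inductive TreeEquiv : SignedTree → SignedTree → Prop
  | of_root {A B} : RootEquiv A B → TreeEquiv A B
  | trans {A B C} : TreeEquiv A B → TreeEquiv B C → TreeEquiv A C
  | swap (s A B) : TreeEquiv (att s A B) (att (-s) B A)

/-- Two signed trees that differ in the signs only. -/
inductive SameShape : SignedTree → SignedTree → Prop
  | pt : SameShape pt pt
  | att {A A' B B'} (s s') : SameShape A A' → SameShape B B' → SameShape (att s A B) (att s' A' B')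

lemma SameShape.code_eq {A B : SignedTree} (h : SameShape A B) : A.code = B.code := by
  induction h with
  | pt => rfl
  | att s s' _ _ ih1 ih2 => simp only [code, ih1, ih2]

lemma RootEquiv.code_eq {A B : SignedTree} (h : RootEquiv A B) : A.code = B.code := by
  induction h with
  | refl => rfl
  | trans _ _ ih1 ih2 => exact ih1.trans ih2
  | comm s s' A B C => simp only [code]; exact mul_right_comm _ _ _
  | congr s _ _ ih1 ih2 => simp only [code, ih1, ih2]

lemma eq_pt_of_code_eq_one {t : SignedTree} (h : t.code = 1) : t = pt := by
  cases t with
  | pt => rfl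
  | att s A B =>
    exact absurd h (ne_of_gt (lt_of_le_of_lt one_le (lt_mul_plant_left A.code B.code)))

/-- Siblings commute, so any child of the root can be made the outermost one. -/
lemma exists_rootEquiv_of_dvd {t : SignedTree} {b : ℕ+} (h : plant b ∣ t.code) :
    ∃ s A B, RootEquiv t (att s A B) ∧ B.code = b := by
  induction t with
  | pt => exact absurd h (not_plant_dvd_one b)
  | att s A B ihA _ =>
    rcases plant_dvd_mul.1 h with h | h
    · obtain ⟨s', A', B', he, hb⟩ := ihA h
      exact ⟨s', att s A' B, B', (RootEquiv.congr s he (.refl B)).trans (.comm _ _ _ _ _), hb⟩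
    · exact ⟨s, A, B, .refl _, (plant_dvd_plant.1 h).symm⟩

lemma exists_rootEquiv_of_code_eq_mul {t : SignedTree} {a b : ℕ+} (h : t.code = a * plant b) :
    ∃ s A B, RootEquiv t (att s A B) ∧ A.code = a ∧ B.code = b := by
  obtain ⟨s, A, B, he, hb⟩ := exists_rootEquiv_of_dvd (t := t) (b := b) ⟨a, by rw [h, mul_comm]⟩
  refine ⟨s, A, B, he, ?_, hb⟩
  have := he.code_eq
  rw [h, code, hb] at this
  exact (mul_right_cancel this).symm

/-- Reordering siblings recursively aligns the underlying trees and leaves the signs as the only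
difference. -/
lemma exists_sameShape_of_code_eq {A B : SignedTree} (h : A.code = B.code) :
    ∃ B', RootEquiv B B' ∧ SameShape A B' := by
  induction A generalizing B with
  | pt => exact ⟨pt, by rw [eq_pt_of_code_eq_one h.symm]; exact .refl _, .pt⟩
  | att s A1 A2 ih1 ih2 =>
    obtain ⟨s', B1, B2, he, h1, h2⟩ := exists_rootEquiv_of_code_eq_mul h.symm
    obtain ⟨B1', e1, f1⟩ := ih1 h1.symm
    obtain ⟨B2', e2, f2⟩ := ih2 h2.symm
    exact ⟨att s' B1' B2', he.trans (.congr s' e1 e2), .att _ _ f1 f2⟩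

lemma exists_treeEquiv_of_reroot {t : SignedTree} {n : ℕ+} (h : Reroot t.code n) :
    ∃ t', TreeEquiv t t' ∧ t'.code = n := by
  generalize hm : t.code = m at h
  induction h generalizing t with
  | refl => exact ⟨t, .of_root (.refl _), hm⟩
  | step a b n _ ih =>
    obtain ⟨s, A, B, he, hA, hB⟩ := exists_rootEquiv_of_code_eq_mul hm
    obtain ⟨t', h1, h2⟩ := ih (t := att (-s) B A) (by rw [code, hA, hB])
    exact ⟨t', ((TreeEquiv.of_root he).trans (.swap s A B)).trans h1, h2⟩

/-! ### Generating functions of subforests -/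

section algebra
variable {𝔸 R : Type*} [CommRing 𝔸] [CommRing R] [Algebra 𝔸 R] (L : R →ₗ[𝔸] R) (tr : R →ₗ[𝔸] 𝔸)

/-- The generating function of the rooted subforests of a signed tree, where `L` plants a tree and
`tr` forgets the root. -/
def rooted : SignedTree → R
  | pt => 1
  -- The new edge is either cut, so that the branch contributes a scalar, or kept with its sign.
  | att s A B => rooted A * (algebraMap 𝔸 R (tr (rooted B)) + (s : ℤ) • L (rooted B))

/-- The generating function of the subforests of a signed tree. -/
def total (t : SignedTree) : 𝔸 := tr (rooted L tr t)

/-- Moving the root along an edge changes the sign, and doubled trees vanish. -/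
structure IsSkew : Prop where
  skew : ∀ g h, tr (g * L h) = - tr (h * L g)
  alt : ∀ g, tr (g * L g) = 0

variable {L tr}

lemma total_att (s : ℤˣ) (A B : SignedTree) :
    total L tr (att s A B) =
      total L tr A * total L tr B + (s : ℤ) • tr (rooted L tr A * L (rooted L tr B)) := by
  rw [total, rooted, mul_add, map_add, mul_comm, ← Algebra.smul_def, map_smul, mul_smul_comm,
    map_zsmul, smul_eq_mul, mul_comm, total, total]

lemma RootEquiv.rooted_eq {A B : SignedTree} (h : RootEquiv A B) :
    rooted L tr A = rooted L tr B := by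
  induction h with
  | refl => rfl
  | trans _ _ ih1 ih2 => exact ih1.trans ih2
  | comm s s' A B C => simp only [rooted]; ring
  | congr s _ _ ih1 ih2 => simp only [rooted, ih1, ih2]

/-- Moving the root reverses the direction in which one edge is seen; the skewness of `tr`
compensates for the new sign. -/
lemma TreeEquiv.total_eq (hs : IsSkew L tr) {A B : SignedTree} (h : TreeEquiv A B) :
    total L tr A = total L tr B := by
  induction h with
  | of_root h => rw [total, total, h.rooted_eq]
  | trans _ _ ih1 ih2 => exact ih1.trans ih2
  | swap s A B =>
    rw [total_att, total_att, hs.skew]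
    simp [mul_comm]

lemma total_att_self (hs : IsSkew L tr) (s : ℤˣ) (A : SignedTree) :
    total L tr (att s A A) = total L tr A ^ 2 := by
  rw [total_att, hs.alt, smul_zero, add_zero, sq]

/-- With `2 = 0` the signs act trivially. -/
lemma SameShape.rooted_eq (h2 : (2 : 𝔸) = 0) {A B : SignedTree} (h : SameShape A B) :
    rooted L tr A = rooted L tr B := by
  have hR : ∀ (s : ℤˣ) (x : R), (s : ℤ) • x = x := by
    intro s x
    have : (2 : R) = 0 := by rw [← map_ofNat (algebraMap 𝔸 R), h2, map_zero]
    rcases Int.units_eq_one_or s with rfl | rfl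
    · simp
    · have hx : x + x = 0 := by rw [← two_mul, this, zero_mul]
      simpa using (eq_neg_of_add_eq_zero_left hx).symm
  induction h with
  | pt => rfl
  | att s s' _ _ ih1 ih2 => simp only [rooted, ih1, ih2, hR]

lemma rooted_eq_of_code_eq (h2 : (2 : 𝔸) = 0) {A B : SignedTree} (h : A.code = B.code) :
    rooted L tr A = rooted L tr B := by
  obtain ⟨B', h3, h4⟩ := exists_sameShape_of_code_eq h
  rw [h4.rooted_eq h2, h3.rooted_eq]

lemma total_att_of_code_eq (h2 : (2 : 𝔸) = 0) (hs : IsSkew L tr) (s : ℤˣ) {A B : SignedTree}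
    (h : A.code = B.code) : total L tr (att s A B) = total L tr A ^ 2 := by
  rw [← total_att_self hs s, total, total, rooted, rooted, rooted_eq_of_code_eq h2 h]

/-- Homomorphisms of the structure carry generating functions to generating functions. -/
lemma map_rooted {𝔸' R' : Type*} [CommRing 𝔸'] [CommRing R'] [Algebra 𝔸' R']
    {L' : R' →ₗ[𝔸'] R'} {tr' : R' →ₗ[𝔸'] 𝔸'} (f : 𝔸 →+* 𝔸') (F : R →+* R')
    (hF : ∀ a, F (algebraMap 𝔸 R a) = algebraMap 𝔸' R' (f a)) (hL : ∀ g, F (L g) = L' (F g))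
    (htr : ∀ g, f (tr g) = tr' (F g)) (t : SignedTree) :
    F (rooted L tr t) = rooted L' tr' t := by
  induction t with
  | pt => simp [rooted]
  | att s A B ihA ihB => simp [rooted, hF, hL, htr, ihA, ihB]

lemma map_total {𝔸' R' : Type*} [CommRing 𝔸'] [CommRing R'] [Algebra 𝔸' R']
    {L' : R' →ₗ[𝔸'] R'} {tr' : R' →ₗ[𝔸'] 𝔸'} (f : 𝔸 →+* 𝔸') (F : R →+* R')
    (hF : ∀ a, F (algebraMap 𝔸 R a) = algebraMap 𝔸' R' (f a)) (hL : ∀ g, F (L g) = L' (F g))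
    (htr : ∀ g, f (tr g) = tr' (F g)) (t : SignedTree) :
    f (total L tr t) = total L' tr' t := by
  rw [total, htr, map_rooted f F hF hL htr, total]

end algebra

/-! ### Formal combinations of codes -/

section formal
variable {𝔸 : Type*} [CommRing 𝔸]

/-- Planting, on formal combinations of codes. -/
noncomputable def formalL (𝔸 : Type*) [CommRing 𝔸] :
    MonoidAlgebra 𝔸 ℕ+ →ₗ[𝔸] MonoidAlgebra 𝔸 ℕ+ :=
  (MonoidAlgebra.coeffLinearEquiv 𝔸).symm.toLinearMap ∘ₗ Finsupp.lmapDomain 𝔸 𝔸 plant ∘ₗ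
    (MonoidAlgebra.coeffLinearEquiv 𝔸).toLinearMap

/-- The linear functional on formal combinations of codes with given values. -/
noncomputable def formalTr (φ : ℕ+ → 𝔸) : MonoidAlgebra 𝔸 ℕ+ →ₗ[𝔸] 𝔸 :=
  Finsupp.linearCombination 𝔸 φ ∘ₗ (MonoidAlgebra.coeffLinearEquiv 𝔸).toLinearMap

@[simp] lemma formalL_single (n : ℕ+) (a : 𝔸) :
    formalL 𝔸 (MonoidAlgebra.single n a) = MonoidAlgebra.single (plant n) a := by
  simp [formalL]

@[simp] lemma formalTr_single (φ : ℕ+ → 𝔸) (n : ℕ+) (a : 𝔸) :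
    formalTr φ (MonoidAlgebra.single n a) = a * φ n := by
  simp [formalTr]

/-- The generating function of the subforests of a signed tree, where a tree with code `n` is
weighted by `φ n`. -/
noncomputable def formalTotal (φ : ℕ+ → 𝔸) (t : SignedTree) : 𝔸 :=
  total (formalL 𝔸) (formalTr φ) t

/-- Both identities extend from basis elements by bilinearity. The diagonal is a separate hypothesis
since skewness only gives `2 * φ (a * plant a) = 0`, which is void modulo two. -/
lemma isSkew_formal {φ : ℕ+ → 𝔸} (h1 : ∀ a b, φ (a * plant b) = - φ (b * plant a))
    (h2 : ∀ a, φ (a * plant a) = 0) : IsSkew (formalL 𝔸) (formalTr φ) := by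
  have skew : ∀ g h, formalTr φ (g * formalL 𝔸 h) = - formalTr φ (h * formalL 𝔸 g) := by
    intro g h
    induction g using MonoidAlgebra.induction_linear with
    | zero => simp
    | add g g' ih ih' => simp only [add_mul, map_add, mul_add, ih, ih', neg_add]
    | single n a =>
      induction h using MonoidAlgebra.induction_linear with
      | zero => simp
      | add g g' ih ih' => simp only [add_mul, map_add, mul_add, ih, ih', neg_add]
      | single m b => simp [h1 n m, mul_comm]
  refine ⟨skew, fun g => ?_⟩
  induction g using MonoidAlgebra.induction_linear with
  | zero => simp
  | add g g' ih ih' =>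
    simp only [add_mul, map_add, mul_add, ih, ih', skew g g']
    ring
  | single n a => simp [h2]

lemma map_formalTotal {𝔹 : Type*} [CommRing 𝔹] (f : 𝔸 →+* 𝔹) (φ : ℕ+ → 𝔸) (t : SignedTree) :
    f (formalTotal φ t) = formalTotal (fun n => f (φ n)) t := by
  have hs : ∀ n a, MonoidAlgebra.mapRingHom ℕ+ f (MonoidAlgebra.single n a) =
      MonoidAlgebra.single n (f a) := by intro n a; simp
  refine map_total f (MonoidAlgebra.mapRingHom ℕ+ f) ?_ ?_ ?_ t
  · intro a
    rw [MonoidAlgebra.coe_algebraMap, MonoidAlgebra.coe_algebraMap]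
    simp
  · intro g
    induction g using MonoidAlgebra.induction_linear with
    | zero => simp
    | add g g' ih ih' => simp only [map_add, ih, ih']
    | single n a => simp
  · intro g
    induction g using MonoidAlgebra.induction_linear with
    | zero => simp
    | add g g' ih ih' => simp only [map_add, ih, ih']
    | single n a => simp

end formal

end SignedTree

open SignedTree

/-! ### Weighted antisymmetric matrices -/

namespace Kernel

section ring
variable {𝔹 X : Type*} [CommRing 𝔹] [Fintype X] (f : X → X → 𝔹) (w : X → 𝔹)

/-- The operator of a kernel `f` on functions on a finite set weighted by `w`. -/
def op : (X → 𝔹) →ₗ[𝔹] (X → 𝔹) where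
  toFun g x := ∑ y, f x y * (w y * g y)
  map_add' g h := by ext x; simp [mul_add, Finset.sum_add_distrib]
  map_smul' a g := by
    ext x
    simp only [Pi.smul_apply, smul_eq_mul, RingHom.id_apply, Finset.mul_sum]
    exact Finset.sum_congr rfl fun y _ => by ring

/-- Integration against the weight `w`. -/
def integral : (X → 𝔹) →ₗ[𝔹] 𝔹 where
  toFun g := ∑ x, w x * g x
  map_add' g h := by simp [mul_add, Finset.sum_add_distrib]
  map_smul' a g := by
    simp only [Pi.smul_apply, smul_eq_mul, RingHom.id_apply, Finset.mul_sum]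
    exact Finset.sum_congr rfl fun y _ => by ring

lemma op_apply (g : X → 𝔹) (x : X) : op f w g x = ∑ y, f x y * (w y * g y) := rfl

lemma integral_apply (g : X → 𝔹) : integral w g = ∑ x, w x * g x := rfl

/-- The homomorphism density of a rooted tree, as a function of the image of the root. -/
noncomputable def branch : ℕ+ →* (X → 𝔹) := lift (op f w)

/-- The homomorphism density of a rooted tree. -/
noncomputable def density (n : ℕ+) : 𝔹 := integral w (branch f w n)

lemma branch_plant (n : ℕ+) : branch f w (plant n) = op f w (branch f w n) := lift_plant _ _

variable {f w}

lemma integral_mul_op (hf : ∀ x y, f x y = - f y x) (g h : X → 𝔹) :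
    integral w (g * op f w h) = - integral w (h * op f w g) := by
  simp only [integral_apply, op_apply, Pi.mul_apply, Finset.mul_sum, ← Finset.sum_neg_distrib]
  rw [Finset.sum_comm]
  refine Finset.sum_congr rfl fun x _ => Finset.sum_congr rfl fun y _ => ?_
  rw [hf y x]; ring

lemma density_swap (hf : ∀ x y, f x y = - f y x) (a b : ℕ+) :
    density f w (a * plant b) = - density f w (b * plant a) := by
  simp only [density, map_mul, branch_plant]
  exact integral_mul_op hf _ _

end ring

/-- A function that changes sign when the root is moved is determined by its values on canonical
forms. -/
lemma eq_sign_mul {φ : ℕ+ → ℚ} (h1 : ∀ a b, φ (a * plant b) = - φ (b * plant a)) (n : ℕ+) :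
    φ n = (canonicalForm n).1 * φ (canonicalForm n).2 := by
  induction n using centroid_induction with
  | light n h => rw [canonicalForm_of_light h]; simp
  | balanced q y h =>
    rw [canonicalForm_of_size_eq h, balancedForm_of_size_eq h]
    split_ifs with h2 h3
    · subst h2
      have := h1 q q
      simp only [Int.cast_zero, zero_mul]
      linarith
    · simp
    · rw [h1]; simp
  | step q y h ih =>
    rw [canonicalForm_of_lt h, h1, ih]; simp [negForm]

/-- The codes of the canonically rooted trees without an edge-flipping automorphism. -/
abbrev Canonical : Type := {c : ℕ+ // canonicalForm c = (1, c)}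

/-- The universal weight of rooted trees. -/
noncomputable def universalWeight (n : ℕ+) : MvPolynomial Canonical ℤ :=
  if h : (canonicalForm n).1 = 0 then 0
  else (canonicalForm n).1 • MvPolynomial.X ⟨(canonicalForm n).2, canonicalForm_canonicalForm h⟩

/-- Over `ℚ` the sign rule itself forces the value `0` on trees that flip an edge, so every such
weight factors through the universal one. -/
lemma aeval_universalWeight {φ : ℕ+ → ℚ} (h1 : ∀ a b, φ (a * plant b) = - φ (b * plant a))
    (n : ℕ+) : MvPolynomial.aeval (fun c : Canonical => φ c.1) (universalWeight n) = φ n := by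
  rw [eq_sign_mul h1 n, universalWeight]
  split_ifs with h
  · simp [h]
  · simp

lemma formalTotal_density {X : Type} [Fintype X] {f : X → X → ℚ} {w : X → ℚ} (t : SignedTree) :
    formalTotal (density f w) t = total (op f w) (integral w) t := by
  let F : MonoidAlgebra ℚ ℕ+ →ₐ[ℚ] (X → ℚ) := MonoidAlgebra.lift ℚ (X → ℚ) ℕ+ (branch f w)
  have hF : ∀ n a, F (MonoidAlgebra.single n a) = a • branch f w n := by
    intro n a; simp [F]
  refine map_total (L := formalL ℚ) (tr := formalTr _) (L' := op f w) (tr' := integral w) (RingHom.id ℚ) F.toRingHom (fun a => F.commutes a) ?_ ?_ t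
  · intro g
    induction g using MonoidAlgebra.induction_linear with
    | zero => simp
    | add g g' ih ih' => simp only [map_add, ih, ih']
    | single n a =>
      change F _ = op f w (F _)
      rw [formalL_single, hF, hF, map_smul, branch_plant]
  · intro g
    induction g using MonoidAlgebra.induction_linear with
    | zero => simp
    | add g g' ih ih' => simp only [map_add, ih, ih']
    | single n a =>
      change formalTr _ _ = integral w (F _)
      rw [formalTr_single, hF, map_smul, density, smul_eq_mul]

lemma aeval_formalTotal {X : Type} [Fintype X] {f : X → X → ℚ} {w : X → ℚ}
    (hf : ∀ x y, f x y = - f y x) (t : SignedTree) :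
    MvPolynomial.aeval (fun c : Canonical => density f w c.1) (formalTotal universalWeight t) =
      total (op f w) (integral w) t := by
  rw [← formalTotal_density]
  have := map_formalTotal
    (MvPolynomial.aeval (fun c : Canonical => density f w c.1)).toRingHom universalWeight t
  refine this.trans ?_
  congr 1
  funext n
  exact aeval_universalWeight (density_swap hf) n

/-! ### Independence of densities -/

/-- A polynomial that vanishes on a subspace which no linear relation between its variables
restricts vanishes. -/
lemma eq_zero_of_vanish {κ : Type*} (Λ : Submodule ℚ (κ → ℚ)) (p : MvPolynomial κ ℚ)
    (hΛ : ∀ c : κ →₀ ℚ, c.support ⊆ p.vars → (∀ v ∈ Λ, (c.sum fun i a => a * v i) = 0) → c = 0)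
    (hp : ∀ v ∈ Λ, MvPolynomial.eval v p = 0) : p = 0 := by
  classical
  let r : (κ → ℚ) →ₗ[ℚ] (p.vars → ℚ) := LinearMap.funLeft ℚ ℚ Subtype.val
  -- Otherwise a nonzero functional on the finitely many variables of `p` would vanish on the
  -- projection of `Λ`; its coefficients form a relation `c` excluded by `hΛ`.
  have htop : Λ.map r = ⊤ := by
    by_contra hne
    obtain ⟨l, hl, hle⟩ := Submodule.exists_le_ker_of_lt_top _ (lt_top_iff_ne_top.2 hne)
    apply hl
    let c : κ →₀ ℚ := ∑ i : p.vars, Finsupp.single i.1 (l (Pi.single i 1))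
    have hl' : ∀ y, l y = ∑ i : p.vars, y i * l (Pi.single i 1) := by
      intro y
      conv_lhs => rw [LinearMap.pi_apply_eq_sum_univ l y]
      refine Finset.sum_congr rfl fun i _ => ?_
      rw [smul_eq_mul]
      congr 2
      funext j
      simp [Pi.single_apply, eq_comm]
    have hc : c = 0 := by
      apply hΛ
      · intro i hi
        rw [Finsupp.mem_support_iff] at hi
        by_contra hn
        apply hi
        rw [Finsupp.finsetSum_apply]
        refine Finset.sum_eq_zero fun j _ => ?_
        rw [Finsupp.single_apply, if_neg]
        rintro rfl
        exact hn j.2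
      · intro v hv
        change (Finsupp.sum (∑ i : p.vars, Finsupp.single i.1 (l (Pi.single i 1)))
          fun i a => a * v i) = 0
        rw [← Finsupp.sum_finsetSum_index (fun _ => zero_mul _) (fun _ _ _ => add_mul _ _ _)]
        have h0 : l (r v) = 0 := hle (Submodule.mem_map_of_mem hv)
        rw [hl'] at h0
        rw [← h0]
        refine Finset.sum_congr rfl fun j _ => ?_
        rw [Finsupp.sum_single_index (by simp), mul_comm]
        rfl
    ext1 i
    ext
    have := DFunLike.congr_fun hc i.1
    rw [Finsupp.finsetSum_apply, Finset.sum_eq_single i] at this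
    · simpa using this
    · intro j _ hj
      rw [Finsupp.single_apply, if_neg (fun h => hj (Subtype.ext h))]
    · simp
  obtain ⟨q, hq⟩ := MvPolynomial.exists_rename_eq_of_vars_subset_range p
    (Subtype.val : p.vars → κ) Subtype.val_injective (by simp)
  have hq0 : q = 0 := by
    apply MvPolynomial.funext
    intro y
    have hy : y ∈ Λ.map r := by rw [htop]; trivial
    obtain ⟨v, hv, rfl⟩ := hy
    have := hp v hv
    rw [← hq, MvPolynomial.eval_rename] at this
    rw [map_zero]
    exact this
  rw [← hq, hq0, map_zero]

/-- The multiset of children of a code. -/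
noncomputable def children : ℕ+ →* ℕ+ × Multiplicative (ℕ+ →₀ ℕ) :=
  -- The first component remembers the code itself, which is needed when it is planted.
  lift fun k => (plant k.1, Multiplicative.ofAdd (Finsupp.single k.1 1))

/-- The number of children of each type. -/
noncomputable def exponents (n : ℕ+) : ℕ+ →₀ ℕ := (children n).2.toAdd

lemma children_fst (n : ℕ+) : (children n).1 = n := by
  induction n using induction_plant with
  | one => simp
  | mul q y hq hy =>
    rw [map_mul, Prod.fst_mul, hq, children, lift_plant]
    change q * plant (children y).1 = _
    rw [hy]

lemma exponents_one : exponents 1 = 0 := by simp [exponents]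

lemma exponents_mul_plant (q y : ℕ+) :
    exponents (q * plant y) = exponents q + Finsupp.single y 1 := by
  rw [exponents, map_mul, Prod.snd_mul, toAdd_mul, exponents]
  congr 1
  rw [children, lift_plant]
  change Finsupp.single (children y).1 1 = _
  rw [children_fst]

lemma prod_exponents (n : ℕ+) : ((exponents n).prod fun b k => plant b ^ k) = n := by
  induction n using induction_plant with
  | one => simp [exponents_one]
  | mul q y hq hy =>
    rw [exponents_mul_plant, Finsupp.prod_add_index' (by simp) (by simp [pow_add]), hq]
    simp

lemma exponents_injective : Function.Injective exponents := fun a b h => by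
  rw [← prod_exponents a, h, prod_exponents]

lemma plant_dvd_of_mem_support {n b : ℕ+} (h : b ∈ (exponents n).support) : plant b ∣ n := by
  induction n using induction_plant with
  | one => simp [exponents_one] at h
  | mul q y hq hy =>
    rw [exponents_mul_plant] at h
    rcases Finset.mem_union.1 (Finsupp.support_add h) with h | h
    · exact (hq h).mul_right _
    · rw [Finset.mem_singleton.1 (Finsupp.support_single_subset h)]
      exact Dvd.intro_left q rfl

section extend
variable {X Y : Type}

/-- The direct sum of two kernels. -/
def sumKernel (f : X → X → ℚ) (g : Y → Y → ℚ) : X ⊕ Y → X ⊕ Y → ℚ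
  | .inl x, .inl x' => f x x'
  | .inr y, .inr y' => g y y'
  | _, _ => 0

lemma sumKernel_neg {f : X → X → ℚ} {g : Y → Y → ℚ} (hf : ∀ x y, f x y = - f y x)
    (hg : ∀ x y, g x y = - g y x) (a b) : sumKernel f g a b = - sumKernel f g b a := by
  rcases a with a | a <;> rcases b with b | b <;> simp [sumKernel]
  · exact hf _ _
  · exact hg _ _

lemma branch_sum [Fintype X] [Fintype Y] (f : X → X → ℚ) (g : Y → Y → ℚ) (w : X → ℚ) (v : Y → ℚ) (n : ℕ+) :
    branch (sumKernel f g) (Sum.elim w v) n = Sum.elim (branch f w n) (branch g v n) := by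
  induction n using induction_plant with
  | one => ext (x | x) <;> simp
  | mul q y hq hy =>
    simp only [map_mul, branch_plant, hq, hy]
    ext (x | x) <;> simp [op_apply, sumKernel]

/-- The kernel `f` together with a new point, which is joined to the others by `u`. -/
def pointKernel (f : X → X → ℚ) (u : X → ℚ) : Option X → Option X → ℚ
  | some x, some x' => f x x'
  | none, some x => u x
  | some x, none => - u x
  | none, none => 0

lemma pointKernel_neg {f : X → X → ℚ} (u : X → ℚ) (hf : ∀ x y, f x y = - f y x) (a b) :
    pointKernel f u a b = - pointKernel f u b a := by
  rcases a with _ | a <;> rcases b with _ | b <;> simp [pointKernel]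
  exact hf _ _

/-- A weight, extended by a new point. -/
def pointWeight (w : X → ℚ) (a : ℚ) : Option X → ℚ
  | some x => w x
  | none => a

lemma branch_point_some [Fintype X] (f : X → X → ℚ) (u w : X → ℚ) (n : ℕ+) (x : X) :
    branch (pointKernel f u) (pointWeight w 0) n (some x) = branch f w n x := by
  induction n using induction_plant generalizing x with
  | one => simp
  | mul q y hq hy =>
    simp only [map_mul, branch_plant, Pi.mul_apply, hq, op_apply, Fintype.sum_option]
    simp [pointKernel, pointWeight, hy]

/-- The new point has weight `0`, so only the root can be mapped to it, and the children of the root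
contribute independent factors. -/
lemma branch_point_none [Fintype X] (f : X → X → ℚ) (u w : X → ℚ) (n : ℕ+) :
    branch (pointKernel f u) (pointWeight w 0) n none =
      MvPolynomial.eval (fun b => integral w (u * branch f w b))
        (MvPolynomial.monomial (exponents n) (1 : ℚ)) := by
  induction n using induction_plant with
  | one => simp [exponents_one]
  | mul q y hq hy =>
    rw [exponents_mul_plant, MvPolynomial.monomial_add_single, pow_one,
      map_mul (MvPolynomial.eval _), ← hq, MvPolynomial.eval_X, map_mul, Pi.mul_apply]
    congr 1
    rw [branch_plant, op_apply, Fintype.sum_option, integral_apply]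
    simp only [pointKernel, pointWeight, branch_point_some, Pi.mul_apply]
    simp only [zero_mul, zero_add]
    exact Finset.sum_congr rfl fun x _ => by ring

/-- Splitting off two opposite twins from a point does not change densities. -/
lemma branch_twin [Fintype X] [DecidableEq X] (f : X → X → ℚ) (hf : ∀ x y, f x y = - f y x) (w : X → ℚ) (z : X)
    (n : ℕ+) :
    (∀ x, branch (pointKernel f (f z)) (pointWeight (w + Pi.single z 1) (-1)) n (some x) =
      branch f w n x) ∧
    branch (pointKernel f (f z)) (pointWeight (w + Pi.single z 1) (-1)) n none =
      branch f w n z := by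
  -- The twins are not joined to each other because `f z z = 0`; elsewhere the added weights `1` and
  -- `-1` cancel.
  have hzz : f z z = 0 := by have := hf z z; linarith
  have hs : ∀ (x : X) (g : X → ℚ),
      ∑ i, f x i * ((Pi.single z 1 : X → ℚ) i * g i) = f x z * g z := by
    intro x g
    rw [Finset.sum_eq_single z]
    · simp
    · intro b _ hb; simp [hb]
    · simp
  induction n using induction_plant with
  | one => simp
  | mul q y hq hy =>
    simp only [map_mul, branch_plant, Pi.mul_apply, hq, op_apply, Fintype.sum_option]
    constructor
    · intro x
      congr 1
      simp only [pointKernel, pointWeight, hy, Pi.add_apply, add_mul, mul_add,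
        Finset.sum_add_distrib, hs, hf z x]
      ring
    · congr 1
      simp only [pointKernel, pointWeight, hy, Pi.add_apply, add_mul, mul_add,
        Finset.sum_add_distrib, hs, hzz]
      ring

end extend

/-- The vectors of the densities of planted trees at a new point. -/
def plantedVectors : Submodule ℚ (ℕ+ → ℚ) where
  carrier := {v | ∃ (X : Type) (_ : Fintype X) (f : X → X → ℚ) (w u : X → ℚ),
    (∀ x y, f x y = - f y x) ∧ v = fun b => integral w (u * branch f w b)}
  zero_mem' := ⟨Empty, inferInstance, fun _ _ => 0, fun _ => 0, fun _ => 0, by simp,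
    by ext; simp [integral_apply]⟩
  add_mem' := by
    rintro _ _ ⟨X, _, f, w, u, hf, rfl⟩ ⟨Y, _, g, v, u', hg, rfl⟩
    refine ⟨X ⊕ Y, inferInstance, sumKernel f g, Sum.elim w v, Sum.elim u u',
      sumKernel_neg hf hg, ?_⟩
    ext b
    simp [integral_apply, branch_sum]
  smul_mem' := by
    rintro a _ ⟨X, _, f, w, u, hf, rfl⟩
    refine ⟨X, inferInstance, f, w, a • u, hf, ?_⟩
    ext b
    rw [smul_mul_assoc, map_smul]
    rfl

/-- Densities of rooted trees at a point of weight `0` are linearly independent. -/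
lemma branch_independent (N : ℕ) (c : ℕ+ →₀ ℚ) (hN : ∀ n ∈ c.support, (n : ℕ) < N)
    (hc : ∀ (X : Type) [Fintype X] (f : X → X → ℚ) (w : X → ℚ) (z : X),
      (∀ x y, f x y = - f y x) → w z = 0 → (c.sum fun n a => a * branch f w n z) = 0) : c = 0 := by
  classical
  induction N generalizing c with
  | zero =>
    ext n
    by_contra h
    exact absurd (hN n (Finsupp.mem_support_iff.2 h)) (Nat.not_lt_zero _)
  | succ N ih =>
    -- At a new point of weight `0` a tree becomes the monomial of its children, so the relation
    -- turns into a polynomial in planted densities. Its variables have smaller codes.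
    let p : MvPolynomial ℕ+ ℚ := c.sum fun n a => MvPolynomial.monomial (exponents n) a
    have hcoeff : ∀ n, p.coeff (exponents n) = c n := by
      intro n
      simp only [p, Finsupp.sum, MvPolynomial.coeff_sum, MvPolynomial.coeff_monomial,
        exponents_injective.eq_iff]
      rw [Finset.sum_ite_eq' c.support n fun m => c m]
      split_ifs with h
      · rfl
      · simpa using (Finsupp.notMem_support_iff.1 h).symm
    have hvars : ∀ b ∈ p.vars, (b : ℕ) < N := by
      intro b hb
      obtain ⟨n, hn, hb⟩ := Finset.mem_biUnion.1 (MvPolynomial.vars_sum_subset _ _ hb)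
      rw [MvPolynomial.vars_monomial (Finsupp.mem_support_iff.1 hn)] at hb
      have h1 := hN n hn
      have h2 : (b : ℕ) < n := by
        obtain ⟨q, rfl⟩ := eq_mul_plant (plant_dvd_of_mem_support hb)
        exact PNat.coe_lt_coe _ _ |>.2 (lt_mul_plant_right q b)
      omega
    have hp : p = 0 := by
      refine eq_zero_of_vanish plantedVectors p (fun d hd hv => ?_) ?_
      · refine ih d (fun n hn => hvars n (hd hn)) ?_
        intro X _ f w z hf hz
        -- The value at `z` must appear as an integral although `z` has weight `0`: give `z` weight
        -- `1` and cancel the effect by a twin of weight `-1`.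
        have := hv _ ⟨Option X, inferInstance, pointKernel f (f z),
          pointWeight (w + Pi.single z 1) (-1), Pi.single (some z) 1, pointKernel_neg _ hf, rfl⟩
        rw [← this]
        refine Finsupp.sum_congr fun n _ => ?_
        congr 1
        rw [integral_apply, Finset.sum_eq_single (some z)]
        · simp [pointWeight, hz, (branch_twin f hf w z n).1]
        · intro b _ hb; simp [hb]
        · simp
      · rintro _ ⟨X, _, f, w, u, hf, rfl⟩
        have := hc (Option X) (pointKernel f u) (pointWeight w 0) none (pointKernel_neg u hf) rfl
        rw [← this]
        simp only [p, Finsupp.sum, map_sum]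
        refine Finset.sum_congr rfl fun n _ => ?_
        rw [branch_point_none, MvPolynomial.eval_monomial, MvPolynomial.eval_monomial, one_mul]
    ext n
    rw [← hcoeff, hp]
    simp

end Kernel

/-! ### Rerootings as derivatives, and algebraic independence -/

namespace Kernel

/-- The codes of the tree `t`, with an additional branch of code `g` at its root, rooted at the
vertices of `t`, with the signs of the distances to the root. -/
noncomputable def reroots : SignedTree → ℕ+ → List (ℤ × ℕ+)
  | .pt, g => [(1, g)]
  | .att _ A B, g =>
    reroots A (g * plant B.code) ++ (reroots B (plant (g * A.code))).map negForm

lemma self_mem_reroots (t : SignedTree) (g : ℕ+) : (1, g * t.code) ∈ reroots t g := by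
  induction t generalizing g with
  | pt => simp [reroots, code]
  | att s A B ihA _ =>
    simp only [reroots, List.mem_append]
    left
    have := ihA (g * plant B.code)
    rwa [mul_right_comm, mul_assoc] at this

lemma canonicalForm_of_mem_reroots {t : SignedTree} {g : ℕ+} {r : ℤ × ℕ+} (h : r ∈ reroots t g) :
    (r.1 = 1 ∨ r.1 = -1) ∧
      canonicalForm r.2 = (r.1 * (canonicalForm (g * t.code)).1, (canonicalForm (g * t.code)).2) := by
  induction t generalizing g r with
  | pt =>
    rw [reroots, List.mem_singleton] at h
    subst h
    simp [code]
  | att s A B ihA ihB =>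
    rw [reroots, List.mem_append] at h
    rcases h with h | h
    · have := ihA h
      rwa [mul_right_comm, mul_assoc] at this
    · obtain ⟨r', hr', rfl⟩ := List.mem_map.1 h
      obtain ⟨h1, h2⟩ := ihB hr'
      refine ⟨?_, ?_⟩
      · rcases h1 with h1 | h1 <;> simp [negForm, h1]
      · change canonicalForm r'.2 = _
        rw [h2, code, ← mul_assoc, mul_comm (plant _) B.code, canonicalForm_swap]
        simp [negForm]

/-- The derivative of a density with respect to the weight of a point is the sum over all
rerootings of the tree. -/
lemma derivation_density {S 𝔹 X : Type} [CommRing S] [CommRing 𝔹] [Algebra S 𝔹]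
    [Fintype X] [DecidableEq X] (D : Derivation S 𝔹 𝔹) {f : X → X → 𝔹} {w : X → 𝔹} (hf : ∀ x y, f x y = - f y x)
    (hD : ∀ x y, D (f x y) = 0) (z : X) (hw : ∀ x, D (w x) = if x = z then 1 else 0)
    (t : SignedTree) (n : ℕ+) :
    D (∑ x, w x * (branch f w t.code x * branch f w n x)) =
      ((reroots t n).map fun r => (r.1 : 𝔹) * branch f w r.2 z).sum +
        ∑ x, w x * (branch f w t.code x * D (branch f w n x)) := by
  induction t generalizing n with
  | pt =>
    simp only [code, map_one, Pi.one_apply, one_mul, map_sum, Derivation.leibniz, hw, reroots,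
      smul_eq_mul, Finset.sum_add_distrib]
    simp [add_comm]
  | att s A B ihA ihB =>
    have h1 : ∀ x, branch f w (code (.att s A B)) x * branch f w n x =
        branch f w A.code x * branch f w (n * plant B.code) x := by
      intro x; simp only [code, map_mul, Pi.mul_apply]; ring
    have h2 : ∀ x, D (branch f w (n * plant B.code) x) =
        branch f w (plant B.code) x * D (branch f w n x) +
          branch f w n x * ∑ y, f x y * D (w y * branch f w B.code y) := by
      intro x
      rw [map_mul, Pi.mul_apply, Derivation.leibniz, branch_plant]
      conv_lhs => rw [op_apply]
      simp only [map_sum, Derivation.leibniz D (f x _), hD, smul_eq_mul, mul_zero, add_zero]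
      rw [op_apply, add_comm]
    have h3 := ihB (plant (n * A.code))
    have h4 : D (∑ x, w x * (branch f w B.code x * branch f w (plant (n * A.code)) x)) =
        ∑ x, w x * (branch f w B.code x * D (branch f w (plant (n * A.code)) x)) +
        ∑ x, branch f w (plant (n * A.code)) x * D (w x * branch f w B.code x) := by
      rw [map_sum, ← Finset.sum_add_distrib]
      refine Finset.sum_congr rfl fun x _ => ?_
      rw [← mul_assoc, Derivation.leibniz]
      simp only [smul_eq_mul]
      ring
    -- The induction hypothesis for `B`, with the rest of the tree hung below its root, minus the
    -- terms in which that rest is differentiated.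
    have h5 : ∑ x, branch f w (plant (n * A.code)) x * D (w x * branch f w B.code x) =
        ((reroots B (plant (n * A.code))).map fun r => (r.1 : 𝔹) * branch f w r.2 z).sum := by
      rw [h4] at h3
      linear_combination h3
    -- Passing the edge from the root of `A` to that of `B` costs the sign recorded by `negForm`.
    have h6 : ∑ x, w x * (branch f w A.code x * (branch f w n x *
          ∑ y, f x y * D (w y * branch f w B.code y))) =
        - ∑ x, branch f w (plant (n * A.code)) x * D (w x * branch f w B.code x) := by
      simp only [branch_plant, op_apply, map_mul, Pi.mul_apply, Finset.mul_sum, Finset.sum_mul,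
        ← Finset.sum_neg_distrib]
      rw [Finset.sum_comm]
      refine Finset.sum_congr rfl fun x _ => Finset.sum_congr rfl fun y _ => ?_
      rw [hf y x]; ring
    simp only [h1]
    rw [ihA (n * plant B.code), reroots, List.map_append, List.sum_append, List.map_map]
    simp only [h2, mul_add, Finset.sum_add_distrib, h6, h5]
    have h7 : ((fun r : ℤ × ℕ+ => (r.1 : 𝔹) * branch f w r.2 z) ∘ negForm) =
        fun r => (-1) * ((r.1 : 𝔹) * branch f w r.2 z) := by
      funext r; simp [negForm]
    rw [h7, List.sum_map_mul_left]
    have h8 : ∀ x, branch f w (code (.att s A B)) x =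
        branch f w A.code x * branch f w (plant B.code) x := by
      intro x; simp only [code, map_mul, Pi.mul_apply]
    simp only [h8]
    have h9 : ∑ x, w x * (branch f w A.code x * branch f w (plant B.code) x * D (branch f w n x)) =
        ∑ x, w x * (branch f w A.code x * (branch f w (plant B.code) x * D (branch f w n x))) :=
      Finset.sum_congr rfl fun x _ => by ring
    rw [h9]
    ring

lemma exists_code_eq (n : ℕ+) : ∃ t : SignedTree, t.code = n := by
  induction n using induction_plant with
  | one => exact ⟨.pt, rfl⟩
  | mul q y hq hy =>
    obtain ⟨A, rfl⟩ := hq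
    obtain ⟨B, rfl⟩ := hy
    exact ⟨.att 1 A B, rfl⟩

lemma map_branch {𝔹 𝔹' X : Type} [CommRing 𝔹] [CommRing 𝔹'] [Fintype X] (e : 𝔹 →+* 𝔹')
    (f : X → X → 𝔹) (w : X → 𝔹) (n : ℕ+) (x : X) :
    e (branch f w n x) = branch (fun x y => e (f x y)) (fun x => e (w x)) n x := by
  induction n using induction_plant generalizing x with
  | one => simp
  | mul q y hq hy => simp only [map_mul, Pi.mul_apply, hq, branch_plant, op_apply, map_sum, hy]

/-- The vectors of the densities of canonical trees. -/
def densityVectors : Submodule ℚ (Canonical → ℚ) where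
  carrier := {v | ∃ (X : Type) (_ : Fintype X) (f : X → X → ℚ) (w : X → ℚ),
    (∀ x y, f x y = - f y x) ∧ v = fun c => density f w c.1}
  zero_mem' := ⟨Empty, inferInstance, fun _ _ => 0, fun _ => 0, by simp,
    by ext; simp [density, integral_apply]⟩
  add_mem' := by
    rintro _ _ ⟨X, _, f, w, hf, rfl⟩ ⟨Y, _, g, v, hg, rfl⟩
    refine ⟨X ⊕ Y, inferInstance, sumKernel f g, Sum.elim w v, sumKernel_neg hf hg, ?_⟩
    ext b
    simp [density, integral_apply, branch_sum]
  smul_mem' := by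
    rintro a _ ⟨X, _, f, w, hf, rfl⟩
    by_cases ha : a = 0
    · refine ⟨Empty, inferInstance, fun _ _ => 0, fun _ => 0, by simp, ?_⟩
      ext
      simp [density, integral_apply, ha]
    -- Dividing the kernel by `a` undoes the scaling of the weight at every vertex except the root,
    -- so densities scale by `a`.
    have hb : ∀ n, branch (fun x y => a⁻¹ * f x y) (a • w) n = branch f w n := by
      intro n
      induction n using induction_plant with
      | one => simp
      | mul q y hq hy =>
        rw [map_mul, map_mul, hq, branch_plant, branch_plant, hy]
        congr 1
        ext x
        simp only [op_apply, Pi.smul_apply, smul_eq_mul]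
        exact Finset.sum_congr rfl fun y _ => by field_simp
    refine ⟨X, inferInstance, fun x y => a⁻¹ * f x y, a • w, fun x y => by
      change a⁻¹ * f x y = -(a⁻¹ * f y x)
      rw [hf x y]; ring, ?_⟩
    ext b
    simp only [density, hb, integral_apply, Pi.smul_apply, smul_eq_mul, Finset.mul_sum]
    exact Finset.sum_congr rfl fun y _ => by ring

/-- Densities of canonical trees are linearly independent. -/
lemma density_independent (c : Canonical →₀ ℚ)
    (hc : ∀ v ∈ densityVectors, (c.sum fun i a => a * v i) = 0) : c = 0 := by
  classical
  choose T hT using exists_code_eq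
  -- The derivative of the relation with respect to the weight of one point, as a combination of
  -- rooted trees to which `branch_independent` applies.
  let d : ℕ+ →₀ ℚ := c.sum fun i a =>
    ((reroots (T i.1) 1).map fun r => Finsupp.single r.2 (a * r.1)).sum
  have hd : d = 0 := by
    have hdsum : ∀ (g : ℕ+ → ℚ), (d.sum fun n a => a * g n) =
        c.sum fun i a => a * ((reroots (T i.1) 1).map fun r => (r.1 : ℚ) * g r.2).sum := by
      intro g
      let l := Finsupp.linearCombination ℚ g
      have hl : (d.sum fun n a => a * g n) = l d := rfl
      rw [hl]
      simp only [d, Finsupp.sum, map_sum]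
      refine Finset.sum_congr rfl fun i _ => ?_
      rw [map_list_sum, List.map_map, ← List.sum_map_mul_left]
      congr 1
      refine List.map_congr_left fun r _ => ?_
      simp only [Function.comp, l, Finsupp.linearCombination_single, smul_eq_mul, mul_assoc]
    refine branch_independent (d.support.sup (fun n => (n : ℕ)) + 1) d
      (fun n hn => Nat.lt_succ_of_le (Finset.le_sup (f := fun n : ℕ+ => (n : ℕ)) hn)) ?_
    intro X _ f w z hf hz
    rw [hdsum]
    let F : X → X → Polynomial ℚ := fun x y => Polynomial.C (f x y)
    let W : X → Polynomial ℚ := fun x =>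
      Polynomial.C (w x) + if x = z then Polynomial.X else 0
    have hF : ∀ x y, F x y = - F y x := by intro x y; simp only [F, hf x y, map_neg]
    have hzero : (c.sum fun i a => Polynomial.C a * density F W i.1) = 0 := by
      apply Polynomial.funext
      intro μ
      have := hc _ ⟨X, inferInstance, f, fun x => w x + if x = z then μ else 0, hf, rfl⟩
      rw [Polynomial.eval_zero, ← this]
      simp only [Finsupp.sum, Polynomial.eval_finsetSum, Polynomial.eval_mul, Polynomial.eval_C]
      refine Finset.sum_congr rfl fun i _ => ?_
      congr 1
      simp only [density, integral_apply, Polynomial.eval_finsetSum, Polynomial.eval_mul]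
      refine Finset.sum_congr rfl fun x _ => ?_
      have h1 : ∀ x, (W x).eval μ = w x + if x = z then μ else 0 := by
        intro x; simp only [W]; split_ifs <;> simp
      rw [h1]
      congr 1
      have h2 := map_branch (Polynomial.evalRingHom μ) F W i.1 x
      simp only [Polynomial.coe_evalRingHom, F, Polynomial.eval_C, h1] at h2
      exact h2
    let D : Derivation ℚ (Polynomial ℚ) (Polynomial ℚ) := Polynomial.derivative'
    have hDapp : ∀ p, D p = Polynomial.derivative p := fun p => rfl
    have hder : ∀ i : ℕ+, D (density F W i) =
        ((reroots (T i) 1).map fun r => (r.1 : Polynomial ℚ) * branch F W r.2 z).sum := by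
      intro i
      have := derivation_density D (w := W) hF (by intro x y; simp [hDapp, F]) z
        (by
          intro x
          have hW : W x = Polynomial.C (w x) + if x = z then Polynomial.X else 0 := rfl
          rw [hDapp, hW]
          split_ifs <;> simp) (T i) 1
      simp only [hT, map_one, Pi.one_apply, mul_one, Derivation.map_one_eq_zero, mul_zero,
        Finset.sum_const_zero, add_zero] at this
      exact this
    have h3 := congrArg (fun p => (D p).eval 0) hzero
    simp only [map_zero, Polynomial.eval_zero, Finsupp.sum, map_sum, Polynomial.eval_finsetSum]
      at h3
    rw [← h3]
    refine Finset.sum_congr rfl fun i _ => ?_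
    rw [Derivation.leibniz, hder, hDapp (Polynomial.C _)]
    rw [Polynomial.derivative_C, smul_zero, add_zero, smul_eq_mul, Polynomial.eval_mul,
      Polynomial.eval_C]
    rw [← Polynomial.coe_evalRingHom, map_list_sum, List.map_map]
    refine congrArg (fun l => c i * List.sum l) ?_
    refine List.map_congr_left fun r _ => ?_
    have h1 : ∀ x, (W x).eval 0 = w x := by
      intro x; simp only [W]; split_ifs <;> simp
    have h2 := map_branch (Polynomial.evalRingHom 0) F W r.2 z
    simp only [Polynomial.coe_evalRingHom, F, Polynomial.eval_C, h1] at h2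
    simp only [Function.comp, map_mul, map_intCast]
    exact congrArg _ h2.symm
  ext i
  have hi := DFunLike.congr_fun hd i.1
  simp only [d, Finsupp.sum, Finsupp.finsetSum_apply, Finsupp.coe_zero, Pi.zero_apply] at hi
  have happ : ∀ (j : Canonical), (((reroots (T j.1) 1).map fun r =>
      Finsupp.single r.2 (c j * (r.1 : ℚ))).sum) i.1 =
        c j * ((reroots (T j.1) 1).map fun r => if r.2 = i.1 then (r.1 : ℚ) else 0).sum := by
    intro j
    rw [← List.sum_map_mul_left, ← Finsupp.applyAddHom_apply, map_list_sum, List.map_map]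
    congr 1
    refine List.map_congr_left fun r _ => ?_
    simp only [Function.comp, Finsupp.applyAddHom_apply, Finsupp.single_apply, mul_ite, mul_zero]
  -- Canonical roots in one rerooting class coincide, with sign `1`. Hence the coefficient of `d` at
  -- `i` is `c i` times a positive number, without cancellation.
  have hform : ∀ (j : Canonical), ∀ r ∈ reroots (T j.1) 1, r.2 = i.1 → j = i ∧ r.1 = 1 := by
    intro j r hr hri
    obtain ⟨-, h⟩ := canonicalForm_of_mem_reroots hr
    rw [hri, one_mul, hT, i.2, j.2] at h
    simp only [Prod.mk.injEq, mul_one] at h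
    exact ⟨Subtype.ext h.2.symm, h.1.symm⟩
  rw [Finset.sum_eq_single i] at hi
  · rw [happ] at hi
    have hpos : 0 < ((reroots (T i.1) 1).map fun r => if r.2 = i.1 then (r.1 : ℚ) else 0).sum := by
      have hnn : ∀ a ∈ (reroots (T i.1) 1).map (fun r => if r.2 = i.1 then (r.1 : ℚ) else 0),
          0 ≤ a := by
        intro a ha
        obtain ⟨r, hr, rfl⟩ := List.mem_map.1 ha
        split_ifs with h
        · simp [(hform i r hr h).2]
        · exact le_rfl
      have hmem := List.mem_map_of_mem (f := fun r : ℤ × ℕ+ => if r.2 = i.1 then (r.1 : ℚ) else 0)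
        (self_mem_reroots (T i.1) 1)
      have := List.single_le_sum hnn _ hmem
      simp only [one_mul, hT, if_true, Int.cast_one] at this
      linarith
    rcases mul_eq_zero.1 hi with h | h
    · exact h
    · exact absurd h hpos.ne'
  · intro j _ hj
    rw [happ]
    apply mul_eq_zero_of_right
    apply List.sum_eq_zero
    intro a ha
    obtain ⟨r, hr, rfl⟩ := List.mem_map.1 ha
    rw [if_neg fun h => hj (hform j r hr h).1]
  · intro h
    rw [happ, Finsupp.notMem_support_iff.1 h, zero_mul]

/-- A polynomial in canonical trees is determined by its values on densities. -/
lemma eq_zero_of_aeval_density (p : MvPolynomial Canonical ℤ)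
    (hp : ∀ (X : Type) [Fintype X] (f : X → X → ℚ) (w : X → ℚ), (∀ x y, f x y = - f y x) →
      MvPolynomial.aeval (fun c : Canonical => density f w c.1) p = 0) : p = 0 := by
  have h : MvPolynomial.map (Int.castRingHom ℚ) p = 0 := by
    refine eq_zero_of_vanish densityVectors _ (fun c _ hc => density_independent c hc) ?_
    rintro _ ⟨X, _, f, w, hf, rfl⟩
    rw [MvPolynomial.eval_map, ← hp X f w hf, MvPolynomial.aeval_def]
    rfl
  exact MvPolynomial.map_injective _ Int.cast_injective (by rw [h, map_zero])

lemma canonicalForm_one : canonicalForm 1 = (1, 1) :=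
  canonicalForm_of_light fun q y he =>
    absurd (lt_mul_plant_left q y) (by rw [← he]; exact not_lt.2 (one_le))

/-- If the densities of all weighted antisymmetric matrices are those of independent vertices, then
the universal generating function is that of independent vertices. -/
lemma formalTotal_eq_of_density {t : SignedTree} {m k : ℕ}
    (h : ∀ (X : Type) [Fintype X] (f : X → X → ℚ) (w : X → ℚ), (∀ x y, f x y = - f y x) →
      (∑ x, w x) ^ m * total (op f w) (integral w) t = (∑ x, w x) ^ (m + k)) :
    formalTotal universalWeight t = universalWeight 1 ^ k := by
  have key : universalWeight 1 ^ m * formalTotal universalWeight t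
      - universalWeight 1 ^ (m + k) = 0 := by
    apply eq_zero_of_aeval_density
    intro X _ f w hf
    have h1 : density f w 1 = ∑ x, w x := by simp [density, integral_apply]
    rw [map_sub, map_mul, map_pow, map_pow, aeval_universalWeight (density_swap hf), h1,
      aeval_formalTotal hf, h X f w hf, sub_self]
  have hne : universalWeight 1 ≠ 0 := by
    have h1 : (canonicalForm 1).1 ≠ 0 := by rw [canonicalForm_one]; exact one_ne_zero
    rw [universalWeight, dif_neg h1]
    exact smul_ne_zero h1 (MvPolynomial.X_ne_zero _)
  rw [pow_add, ← mul_sub] at key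
  exact sub_eq_zero.1 ((mul_eq_zero.1 key).resolve_left (pow_ne_zero _ hne))

end Kernel

open Kernel

/-! ### Test weights: an indeterminate for a single tree -/

namespace SignedTree

open Polynomial

section testWeight
variable (𝔸 : Type*) [CommRing 𝔸] (N : ℕ+)

/-- The weight of rooted trees that gives the weight `1` to the tree with one vertex, the weight `X`
to the tree with code `N`, and the weight `0` to the other canonically rooted trees. -/
noncomputable def testWeight (n : ℕ+) : 𝔸[X] :=
  ((canonicalForm n).1 : 𝔸[X]) *
    if (canonicalForm n).2 = 1 then 1 else if (canonicalForm n).2 = N then X else 0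

/-- The generating function of the subforests of a signed tree for the test weight. -/
noncomputable def testTotal (t : SignedTree) : 𝔸[X] := formalTotal (testWeight 𝔸 N) t

lemma isSkew_testWeight : IsSkew (formalL 𝔸[X]) (formalTr (testWeight 𝔸 N)) := by
  apply isSkew_formal
  · intro a b
    rw [testWeight, testWeight, canonicalForm_swap b a]
    change ((-(canonicalForm (b * plant a)).1 : ℤ) : 𝔸[X]) *
      (if (canonicalForm (b * plant a)).2 = 1 then 1
        else if (canonicalForm (b * plant a)).2 = N then X else 0) = _
    rw [Int.cast_neg, neg_mul]
  · intro a
    simp [testWeight, canonicalForm_mul_plant_self]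

variable {N}

/-- The test weight is a specialization of the universal weight that sends the single vertex to `1`.
-/
lemma testTotal_eq_one_of_universal {t : SignedTree} {k : ℕ}
    (h : formalTotal universalWeight t = universalWeight 1 ^ k) : testTotal 𝔸 N t = 1 := by
  let e : MvPolynomial Canonical ℤ →+* 𝔸[X] :=
    MvPolynomial.eval₂Hom (Int.castRingHom _)
      fun c => if c.1 = 1 then 1 else if c.1 = N then X else 0
  have he : ∀ n, e (universalWeight n) = testWeight 𝔸 N n := by
    intro n
    rw [universalWeight, testWeight]
    by_cases h0 : (canonicalForm n).1 = 0
    · rw [dif_pos h0, h0, map_zero, Int.cast_zero, zero_mul]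
    · rw [dif_neg h0]
      rw [map_zsmul, zsmul_eq_mul]
      simp [e]
  have h1 := congrArg e h
  rw [map_formalTotal] at h1
  simp only [he, map_pow] at h1
  rw [testTotal, h1]
  simp [testWeight, canonicalForm_one]

lemma testTotal_map {𝔸} [CommRing 𝔸] {𝔹 : Type*} [CommRing 𝔹] (f : 𝔸 →+* 𝔹) (t : SignedTree) :
    (testTotal 𝔸 N t).map f = testTotal 𝔹 N t := by
  rw [testTotal, ← coe_mapRingHom, map_formalTotal]
  congr 1
  funext n
  rw [testWeight, testWeight]
  split_ifs <;> simp

lemma eq_one_of_size_le_one {n : ℕ+} (h : size n ≤ 1) : n = 1 :=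
  size_eq_one.1 (le_antisymm h (size_pos n))

lemma canonicalForm_snd_eq_one {n : ℕ+} (h : (canonicalForm n).2 = 1) : n = 1 := by
  apply size_eq_one.1
  rw [← size_canonicalForm, h, size_one]

/-- At `X = 0` only the single vertex keeps a nonzero weight, so only the forest without edges
survives. -/
lemma coeff_zero_testTotal (t : SignedTree) : (testTotal 𝔸 N t).coeff 0 = 1 := by
  have hφ : ∀ n, constantCoeff (testWeight 𝔸 N n) = if n = 1 then 1 else 0 := by
    intro n
    rw [testWeight]
    by_cases h : n = 1
    · subst h
      simp [canonicalForm_one]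
    · rw [if_neg fun h1 => h (canonicalForm_snd_eq_one h1), if_neg h]
      split_ifs <;> simp
  have h0 : ∀ g h, formalTr (fun n => if n = 1 then (1 : 𝔸) else 0) (g * formalL 𝔸 h) = 0 := by
    intro g h
    induction g using MonoidAlgebra.induction_linear with
    | zero => simp
    | add g g' ih ih' => simp only [add_mul, map_add, ih, ih', add_zero]
    | single n a =>
      induction h using MonoidAlgebra.induction_linear with
      | zero => simp
      | add g g' ih ih' => simp only [map_add, mul_add, ih, ih', add_zero]
      | single m b =>
        have : n * plant m ≠ 1 := fun he => by
          have := lt_mul_plant_left n m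
          rw [he] at this
          exact absurd this (not_lt.2 one_le)
        simp [-mul_eq_one, this]
  rw [testTotal, ← constantCoeff_apply, map_formalTotal]
  simp only [hφ]
  induction t with
  | pt => 
    change formalTr _ (MonoidAlgebra.single 1 1) = 1
    simp
  | att s A B ihA ihB =>
    rw [formalTotal] at *
    rw [total_att, ihA, ihB, h0]
    simp

variable (N) in
/-- Combinations of codes, bounded by the degree of the coefficients and the sizes. -/
noncomputable def bounded (k l : ℕ) : AddSubmonoid (MonoidAlgebra 𝔸[X] ℕ+) :=
  AddSubmonoid.closure {g | ∃ n a, g = MonoidAlgebra.single n a ∧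
    -- Each `X` stands for a component `N` and counts with its size: the first bound concerns all
    -- vertices used, the second those in the component of the root.
    a.natDegree * size N + size n ≤ k ∧ size n ≤ l}

variable {𝔸}

lemma bounded_mono {k l k' l' : ℕ} (hk : k ≤ k') (hl : l ≤ l') :
    bounded 𝔸 N k l ≤ bounded 𝔸 N k' l' := by
  apply AddSubmonoid.closure_mono
  rintro _ ⟨n, a, rfl, h1, h2⟩
  exact ⟨n, a, rfl, h1.trans hk, h2.trans hl⟩

lemma zsmul_mem_bounded {k l : ℕ} {g : MonoidAlgebra 𝔸[X] ℕ+} (s : ℤ)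
    (hg : g ∈ bounded 𝔸 N k l) : s • g ∈ bounded 𝔸 N k l := by
  induction hg using AddSubmonoid.closure_induction with
  | zero => simp [zero_mem]
  | add g g' _ _ ih ih' => rw [smul_add]; exact add_mem ih ih'
  | mem g hg =>
    obtain ⟨n, a, rfl, h1, h2⟩ := hg
    apply AddSubmonoid.subset_closure
    refine ⟨n, s • a, by rw [MonoidAlgebra.smul_single], ?_, h2⟩
    have := Nat.mul_le_mul_right (size N) (natDegree_smul_le s a)
    omega

lemma mul_formalL_mem_bounded {k l k' l' : ℕ} {g h : MonoidAlgebra 𝔸[X] ℕ+}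
    (hg : g ∈ bounded 𝔸 N k l) (hh : h ∈ bounded 𝔸 N k' l') :
    g * formalL _ h ∈ bounded 𝔸 N (k + k') (l + l') := by
  induction hg using AddSubmonoid.closure_induction with
  | zero => simp [zero_mem]
  | add g g' _ _ ih ih' => rw [add_mul]; exact add_mem ih ih'
  | mem g hg =>
    induction hh using AddSubmonoid.closure_induction with
    | zero => simp [zero_mem]
    | add g g' _ _ ih ih' => rw [map_add, mul_add]; exact add_mem ih ih'
    | mem h hh =>
      obtain ⟨n, a, rfl, h1, h2⟩ := hg
      obtain ⟨m, b, rfl, h3, h4⟩ := hh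
      apply AddSubmonoid.subset_closure
      refine ⟨n * plant m, a * b, by simp, ?_, by rw [size_mul_plant]; omega⟩
      rw [size_mul_plant]
      have := Nat.mul_le_mul_right (size N) (natDegree_mul_le (p := a) (q := b))
      rw [add_mul] at this
      omega

lemma mul_algebraMap_mem_bounded {k l k' : ℕ} {g : MonoidAlgebra 𝔸[X] ℕ+} {b : 𝔸[X]}
    (hg : g ∈ bounded 𝔸 N k l) (hb : b.natDegree * size N ≤ k') :
    g * algebraMap _ _ b ∈ bounded 𝔸 N (k + k') l := by
  induction hg using AddSubmonoid.closure_induction with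
  | zero => simp [zero_mem]
  | add g g' _ _ ih ih' => rw [add_mul]; exact add_mem ih ih'
  | mem g hg =>
    obtain ⟨n, a, rfl, h1, h2⟩ := hg
    apply AddSubmonoid.subset_closure
    refine ⟨n, a * b, by simp [MonoidAlgebra.coe_algebraMap], ?_, h2⟩
    have := Nat.mul_le_mul_right (size N) (natDegree_mul_le (p := a) (q := b))
    rw [add_mul] at this
    omega

lemma natDegree_testWeight (n : ℕ+) : (testWeight 𝔸 N n).natDegree * size N ≤ size n := by
  have hle : ∀ q : 𝔸[X], (((canonicalForm n).1 : 𝔸[X]) * q).natDegree ≤ q.natDegree := fun q =>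
    natDegree_mul_le.trans (by simp)
  rw [testWeight]
  split_ifs with h1 h2
  · simp
  · rw [← h2, size_canonicalForm]
    exact (Nat.mul_le_mul_right _ ((hle _).trans natDegree_X_le)).trans (one_mul _).le
  · simp

lemma natDegree_formalTr {k l : ℕ} {g : MonoidAlgebra 𝔸[X] ℕ+} (hg : g ∈ bounded 𝔸 N k l) :
    (formalTr (testWeight 𝔸 N) g).natDegree * size N ≤ k := by
  have hpos := size_pos N
  induction hg using AddSubmonoid.closure_induction with
  | zero => simp
  | add g g' _ _ ih ih' =>
    rw [← Nat.le_div_iff_mul_le hpos] at *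
    rw [map_add]
    exact natDegree_add_le_of_degree_le ih ih'
  | mem g hg =>
    obtain ⟨n, a, rfl, h1, h2⟩ := hg
    rw [formalTr_single]
    have := Nat.mul_le_mul_right (size N) (natDegree_mul_le (p := a) (q := testWeight 𝔸 N n))
    rw [add_mul] at this
    have := natDegree_testWeight (𝔸 := 𝔸) (N := N) n
    omega

lemma size_code_att (s : ℤˣ) (A B : SignedTree) :
    size (att s A B).code = size A.code + size B.code := by
  rw [code, size_mul_plant]

/-- Keeping every edge gives the tree itself, with the product of its signs; every other subforest
has a smaller component at the root. -/
lemma exists_rooted_eq (t : SignedTree) : ∃ (s : ℤˣ), ∃ r ∈ bounded 𝔸 N (size t.code) (size t.code - 1),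
    rooted (formalL _) (formalTr (testWeight 𝔸 N)) t =
      MonoidAlgebra.single t.code (((s : ℤ) : 𝔸[X])) + r := by
  induction t with
  | pt => exact ⟨1, 0, zero_mem _, by simp [rooted, code, MonoidAlgebra.one_def]⟩
  | att s A B ihA ihB =>
    obtain ⟨sA, rA, hA, eA⟩ := ihA
    obtain ⟨sB, rB, hB, eB⟩ := ihB
    have hs : ∀ (n : ℕ+) (u : ℤˣ), MonoidAlgebra.single n (((u : ℤ) : 𝔸[X])) ∈
        bounded 𝔸 N (size n) (size n) := by
      intro n u
      apply AddSubmonoid.subset_closure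
      exact ⟨n, _, rfl, by simp, le_rfl⟩
    have hA' : rooted (formalL _) (formalTr (testWeight 𝔸 N)) A ∈
        bounded 𝔸 N (size A.code) (size A.code) := by
      rw [eA]
      exact add_mem (hs _ _) (bounded_mono le_rfl (Nat.sub_le _ _) hA)
    have hB' : rooted (formalL _) (formalTr (testWeight 𝔸 N)) B ∈
        bounded 𝔸 N (size B.code) (size B.code) := by
      rw [eB]
      exact add_mem (hs _ _) (bounded_mono le_rfl (Nat.sub_le _ _) hB)
    have hpA := size_pos A.code
    have hpB := size_pos B.code
    refine ⟨s * sA * sB, rooted (formalL _) (formalTr (testWeight 𝔸 N)) A *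
        algebraMap _ _ (formalTr (testWeight 𝔸 N)
          (rooted (formalL _) (formalTr (testWeight 𝔸 N)) B)) +
      (s : ℤ) • (MonoidAlgebra.single A.code (((sA : ℤ) : 𝔸[X])) * formalL _ rB +
        rA * formalL _ (rooted (formalL _) (formalTr (testWeight 𝔸 N)) B)), ?_, ?_⟩
    · rw [size_code_att]
      refine add_mem ?_ (zsmul_mem_bounded _ (add_mem ?_ ?_))
      · exact bounded_mono le_rfl (by omega)
          (mul_algebraMap_mem_bounded hA' (natDegree_formalTr hB'))
      · exact bounded_mono le_rfl (by omega) (mul_formalL_mem_bounded (hs _ _) hB)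
      · exact bounded_mono le_rfl (by omega) (mul_formalL_mem_bounded hA hB')
    · have h1 : MonoidAlgebra.single (att s A B).code (((s * sA * sB : ℤˣ) : ℤ) : 𝔸[X]) =
          (s : ℤ) • (MonoidAlgebra.single A.code (((sA : ℤ) : 𝔸[X])) *
            formalL _ (MonoidAlgebra.single B.code (((sB : ℤ) : 𝔸[X])))) := by
        rw [formalL_single, MonoidAlgebra.single_mul_single, code]
        simp [MonoidAlgebra.smul_single, mul_assoc]
      rw [h1, rooted]
      have h2 := eA
      have h3 := congrArg (formalL _) eB
      rw [map_add] at h3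
      rw [mul_add, mul_smul_comm]
      rw [add_left_comm, ← smul_add]
      congr 2
      rw [h3, eA]
      ring

/-- The degree of the generating function is bounded by the size. -/
lemma natDegree_testTotal (t : SignedTree) :
    (testTotal 𝔸 N t).natDegree * size N ≤ size t.code := by
  obtain ⟨s, r, hr, he⟩ := exists_rooted_eq (𝔸 := 𝔸) (N := N) t
  apply natDegree_formalTr (l := size t.code)
  rw [he]
  refine add_mem (AddSubmonoid.subset_closure ⟨_, _, rfl, by simp, le_rfl⟩)
    (bounded_mono le_rfl (Nat.sub_le _ _) hr)

/-- There is no room for `N`: the component of the root takes at least one vertex, and is itself too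
small to be `N`. -/
lemma natDegree_formalTr_eq_zero {g : MonoidAlgebra 𝔸[X] ℕ+} {k : ℕ} (hk : k ≤ size N)
    (hg : g ∈ bounded 𝔸 N k (k - 1)) : (formalTr (testWeight 𝔸 N) g).natDegree = 0 := by
  induction hg using AddSubmonoid.closure_induction with
  | zero => simp
  | add g g' _ _ ih ih' =>
    rw [map_add]
    exact Nat.le_zero.1 (natDegree_add_le_of_degree_le ih.le ih'.le)
  | mem g hg =>
    obtain ⟨n, a, rfl, h1, h2⟩ := hg
    have hn := size_pos n
    have h3 : ∀ q : 𝔸[X], q.natDegree * size N < size N → q.natDegree = 0 := by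
      intro q hq
      by_contra h
      have := Nat.mul_le_mul_right (size N) (Nat.one_le_iff_ne_zero.2 h)
      omega
    rw [formalTr_single]
    apply Nat.le_zero.1
    refine natDegree_mul_le.trans ?_
    rw [h3 a (by omega), h3 (testWeight 𝔸 N n)]
    have := natDegree_testWeight (𝔸 := 𝔸) (N := N) n
    omega

/-- The linear coefficient of the generating function detects trees of the same size. -/
lemma exists_coeff_one_testTotal {t : SignedTree} (h : size t.code = size N) :
    ∃ s : ℤˣ, (testTotal 𝔸 N t).coeff 1 = ((s : ℤ) : 𝔸) * (testWeight 𝔸 N t.code).coeff 1 := by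
  obtain ⟨s, r, hr, he⟩ := exists_rooted_eq (𝔸 := 𝔸) (N := N) t
  refine ⟨s, ?_⟩
  rw [testTotal, formalTotal, total, he, map_add, coeff_add, formalTr_single,
    coeff_eq_zero_of_natDegree_lt (p := formalTr _ r), add_zero, ← C_eq_intCast, coeff_C_mul]
  rw [natDegree_formalTr_eq_zero h.le hr]
  exact one_pos

end testWeight

/-! ### Generating functions modulo two -/

section modTwo
variable {N : ℕ+}

lemma coeff_one_testWeight (hN : N ≠ 1) (n : ℕ+) :
    (testWeight (ZMod 2) N n).coeff 1 =
      if (canonicalForm n).1 ≠ 0 ∧ (canonicalForm n).2 = N then 1 else 0 := by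
  rw [testWeight]
  rcases canonicalForm_sign n with h | h | h <;> rw [h]
  · simp
  · by_cases h2 : (canonicalForm n).2 = N
    · simp [h2, hN]
    · by_cases h3 : (canonicalForm n).2 = 1 <;> simp [h2, h3, coeff_one, Ne.symm hN]
  · by_cases h2 : (canonicalForm n).2 = N
    · simp [h2, hN]
    · by_cases h3 : (canonicalForm n).2 = 1 <;> simp [h2, h3, coeff_one, Ne.symm hN]

lemma coeff_one_testTotal (hN : N ≠ 1) {t : SignedTree} (h : size t.code = size N) :
    (testTotal (ZMod 2) N t).coeff 1 =
      if (canonicalForm t.code).1 ≠ 0 ∧ (canonicalForm t.code).2 = N then 1 else 0 := by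
  obtain ⟨s, hs⟩ := exists_coeff_one_testTotal (𝔸 := ZMod 2) h
  rw [hs, coeff_one_testWeight hN]
  rcases Int.units_eq_one_or s with rfl | rfl <;> simp

/-- All generating functions are trivial modulo two. -/
def TrivialModTwo (t : SignedTree) : Prop :=
  ∀ N, N ≠ 1 → canonicalForm N = (1, N) → testTotal (ZMod 2) N t = 1

lemma two_eq_zero_zmod : (2 : (ZMod 2)[X]) = 0 := by
  rw [← C_ofNat 2, show (2 : ZMod 2) = 0 from rfl, C_0]

/-- Tested against its own canonical form, a tree that flips no edge would have linear coefficient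
`1`. -/
lemma sign_eq_zero_of_trivialModTwo {t : SignedTree} (h : TrivialModTwo t) (ht : 2 ≤ size t.code) :
    (canonicalForm t.code).1 = 0 := by
  by_contra h0
  have hN : (canonicalForm t.code).2 ≠ 1 := by
    intro h1
    rw [canonicalForm_snd_eq_one h1, size_one] at ht
    omega
  have h1 := coeff_one_testTotal hN (t := t) (size_canonicalForm _).symm
  rw [h _ hN (canonicalForm_canonicalForm h0), if_pos ⟨h0, rfl⟩, coeff_one] at h1
  simp at h1

/-- A tree that flips an edge is, modulo two, a square. -/
lemma exists_double_of_sign_eq_zero {t : SignedTree} (h : (canonicalForm t.code).1 = 0) :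
    ∃ s A B, TreeEquiv t (att s A B) ∧ A.code = B.code ∧ (Rigid A.code → Rigid t.code) ∧
      ∀ N, testTotal (ZMod 2) N t = testTotal (ZMod 2) N A ^ 2 := by
  obtain ⟨a, hr, hrig⟩ := exists_reroot_of_sign_eq_zero h
  obtain ⟨t', h1, h2⟩ := exists_treeEquiv_of_reroot hr
  obtain ⟨s, A, B, h3, hA, hB⟩ := exists_rootEquiv_of_code_eq_mul h2
  have h4 := h1.trans (.of_root h3)
  refine ⟨s, A, B, h4, hA.trans hB.symm, by rwa [hA], fun N => ?_⟩
  rw [testTotal, formalTotal, h4.total_eq (isSkew_testWeight _ N),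
    total_att_of_code_eq two_eq_zero_zmod (isSkew_testWeight _ N) s (hA.trans hB.symm)]
  rfl

lemma TreeEquiv.size_eq {A B : SignedTree} (h : TreeEquiv A B) : size A.code = size B.code := by
  induction h with
  | of_root h => rw [h.code_eq]
  | trans _ _ ih1 ih2 => exact ih1.trans ih2
  | swap s A B => rw [size_code_att, size_code_att, add_comm]

/-- The polynomial of the half squares to `1`; since `(P - 1) ^ 2 = P ^ 2 - 1` modulo two and the
ring is reduced, it is `1`. -/
lemma exists_double_of_trivialModTwo {t : SignedTree} (h : TrivialModTwo t)
    (ht : 2 ≤ size t.code) :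
    ∃ s A B, TreeEquiv t (att s A B) ∧ A.code = B.code ∧ TrivialModTwo A ∧
      (Rigid A.code → Rigid t.code) := by
  obtain ⟨s, A, B, h1, h2, h3, h4⟩ :=
    exists_double_of_sign_eq_zero (sign_eq_zero_of_trivialModTwo h ht)
  refine ⟨s, A, B, h1, h2, fun N hN hc => ?_, h3⟩
  have h5 : (testTotal (ZMod 2) N A - 1) ^ 2 = 0 := by
    have h6 := h4 N
    rw [h N hN hc] at h6
    linear_combination h6.symm + (1 - testTotal (ZMod 2) N A) * two_eq_zero_zmod
  exact sub_eq_zero.1 (pow_eq_zero_iff two_ne_zero |>.1 h5)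

/-- Repeated halving ends at the single vertex; each step back doubles the size and preserves
rigidity. -/
lemma TrivialModTwo.rigid {t : SignedTree} (h : TrivialModTwo t) :
    Rigid t.code ∧ ∃ m, size t.code = 2 ^ m := by
  induction hn : size t.code using Nat.strong_induction_on generalizing t with
  | _ n ih =>
    by_cases ht : 2 ≤ size t.code
    · obtain ⟨s, A, B, h1, h2, h3, h4⟩ := exists_double_of_trivialModTwo h ht
      have h5 := h1.size_eq
      rw [size_code_att, ← h2] at h5
      have hpos := size_pos A.code
      obtain ⟨h6, m, h7⟩ := ih _ (by omega) h3 rfl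
      exact ⟨h4 h6, m + 1, by rw [← hn, h5, h7]; ring⟩
    · have h1 := eq_one_of_size_le_one (n := t.code) (by omega)
      exact ⟨h1 ▸ Rigid.one, 0, by rw [← hn, h1, size_one, pow_zero]⟩

/-- Every tree is, modulo two, a power of one that does not flip an edge. -/
lemma exists_core (t : SignedTree) : ∃ (t' : SignedTree) (j : ℕ), size t.code = 2 ^ j * size t'.code ∧
    (canonicalForm t'.code).1 ≠ 0 ∧ (j = 0 → t' = t) ∧
      (j ≠ 0 → (canonicalForm t.code).1 = 0) ∧
      ∀ N, testTotal (ZMod 2) N t = testTotal (ZMod 2) N t' ^ 2 ^ j := by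
  induction hn : size t.code using Nat.strong_induction_on generalizing t with
  | _ n ih =>
    by_cases h0 : (canonicalForm t.code).1 = 0
    · obtain ⟨s, A, B, h1, h2, -, h4⟩ := exists_double_of_sign_eq_zero h0
      have h5 := h1.size_eq
      rw [size_code_att, ← h2] at h5
      have hpos := size_pos A.code
      obtain ⟨t', j, h6, h7, -, -, h8⟩ := ih _ (by omega) A rfl
      refine ⟨t', j + 1, by rw [← hn, h5, h6]; ring, h7, by simp, fun _ => h0, fun N => ?_⟩
      rw [h4, h8, ← pow_mul, pow_succ]
    · exact ⟨t, 0, by rw [← hn]; simp, h0, fun _ => rfl, by simp, fun N => by simp⟩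

end modTwo

end SignedTree

/-! ### Comparison of the two halves modulo four -/

namespace SignedTree

open Polynomial

/-- The parts into which a signed tree falls when an edge is removed at which it differs from a
signed tree of the same shape: the branch that is cut off, and the rest. -/
def diff : SignedTree → SignedTree → List (SignedTree × SignedTree)
  | att s A₁ A₂, att s' B₁ B₂ =>
    (if s = s' then [] else [(A₂, A₁)]) ++ ((diff A₁ B₁).map fun r => (r.1, att s r.2 A₂)) ++
      (diff A₂ B₂).map fun r => (r.1, att s A₁ r.2)
  | _, _ => []

lemma SameShape.eq_of_diff {A B : SignedTree} (h : SameShape A B) (hd : diff A B = []) :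
    A = B := by
  induction h with
  | pt => rfl
  | att s s' _ _ ih1 ih2 =>
    simp only [diff, List.append_eq_nil_iff, List.map_eq_nil_iff] at hd
    rw [ih1 hd.1.2, ih2 hd.2]
    by_cases hs : s = s'
    · rw [hs]
    · simp [hs] at hd

lemma size_of_mem_diff {A B : SignedTree} {r : SignedTree × SignedTree} (h : r ∈ diff A B) :
    size r.1.code + size r.2.code = size A.code := by
  induction A generalizing B r with
  | pt => simp [diff] at h
  | att s A₁ A₂ ih1 ih2 =>
    cases B with
    | pt => simp [diff] at h
    | att s' B₁ B₂ =>
      simp only [diff, List.mem_append, List.mem_map] at h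
      rw [size_code_att]
      rcases h with (h | ⟨r', h, rfl⟩) | ⟨r', h, rfl⟩
      · split_ifs at h with hs
        · simp at h
        · rw [List.mem_singleton] at h
          subst h
          exact add_comm _ _
      · have := ih1 h
        change size r'.1.code + size (att s _ _).code = _
        rw [size_code_att]
        omega
      · have := ih2 h
        change size r'.1.code + size (att s _ _).code = _
        rw [size_code_att]
        omega

lemma size_lt_of_mem_diff {A B : SignedTree} {r : SignedTree × SignedTree} (h : r ∈ diff A B) :
    size r.2.code < size A.code := by
  have := size_of_mem_diff h
  have := size_pos r.1.code
  omega

/-- Only a cut inside `A₁` leaves `A₂` as a child of the root. A cut of the new edge leaves `A₁`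
alone, and a cut inside `A₂` leaves `A₁` with a smaller branch. -/
lemma nodup_diff {A B : SignedTree} (h : Rigid A.code) :
    ((diff A B).map fun r => r.2.code).Nodup := by
  induction A generalizing B with
  | pt => simp [diff]
  | att s A₁ A₂ ih1 ih2 =>
    cases B with
    | pt => simp [diff]
    | att s' B₁ B₂ =>
      obtain ⟨h1, h2, h3⟩ := h.of_mul_plant
      simp only [diff, List.map_append, List.map_map]
      have e1 : ((fun r : SignedTree × SignedTree => r.2.code) ∘
          fun r : SignedTree × SignedTree => (r.1, att s r.2 A₂)) =
          (fun q => q * plant A₂.code) ∘ fun r : SignedTree × SignedTree => r.2.code := rfl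
      have e2 : ((fun r : SignedTree × SignedTree => r.2.code) ∘
          fun r : SignedTree × SignedTree => (r.1, att s A₁ r.2)) =
          (fun q => A₁.code * plant q) ∘ fun r : SignedTree × SignedTree => r.2.code := rfl
      have n1 : (((diff A₁ B₁).map fun r => r.2.code).map (fun q => q * plant A₂.code)).Nodup :=
        (ih1 h1).map fun _ _ he => mul_right_cancel he
      have n2 : (((diff A₂ B₂).map fun r => r.2.code).map (fun q => A₁.code * plant q)).Nodup :=
        (ih2 h2).map fun _ _ he => plant_injective (mul_left_cancel he)
      rw [e1, e2, ← List.map_map, ← List.map_map, List.nodup_append', List.nodup_append']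
      refine ⟨⟨by split_ifs <;> simp, n1, ?_⟩, n2, ?_⟩
      · intro x hx hx'
        split_ifs at hx with hs
        · simp at hx
        · simp only [List.map_cons, List.map_nil, List.mem_singleton] at hx
          obtain ⟨q, -, rfl⟩ := List.mem_map.1 hx'
          exact h3 ⟨q, by rw [← hx, mul_comm]⟩
      · intro x hx hx'
        obtain ⟨q, hq, rfl⟩ := List.mem_map.1 hx'
        obtain ⟨r, hr, rfl⟩ := List.mem_map.1 hq
        have hlt := size_lt_of_mem_diff hr
        rcases List.mem_append.1 hx with hx | hx
        · split_ifs at hx with hs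
          · simp at hx
          · simp only [List.map_cons, List.map_nil, List.mem_singleton] at hx
            exact absurd hx (lt_mul_plant_left _ _).ne'
        · obtain ⟨q, -, he⟩ := List.mem_map.1 hx
          have : plant A₂.code ∣ A₁.code * plant r.2.code := ⟨q, by rw [← he, mul_comm]⟩
          rcases plant_dvd_mul.1 this with h4 | h4
          · exact h3 h4
          · rw [plant_dvd_plant.1 h4] at hlt
            exact lt_irrefl _ hlt

section algebra
variable {𝔸 R : Type*} [CommRing 𝔸] [CommRing R] [Algebra 𝔸 R] {L : R →ₗ[𝔸] R} {tr : R →ₗ[𝔸] 𝔸}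

variable (L tr) in
/-- The sum of the generating functions of the parts of signed trees. -/
def rootedSum (l : List (SignedTree × SignedTree)) : R :=
  (l.map fun r => total L tr r.1 • rooted L tr r.2).sum

lemma rootedSum_append (l l' : List (SignedTree × SignedTree)) :
    rootedSum L tr (l ++ l') = rootedSum L tr l + rootedSum L tr l' := by
  simp [rootedSum]

lemma rootedSum_map_left (s : ℤˣ) (A : SignedTree) (l : List (SignedTree × SignedTree)) :
    rootedSum L tr (l.map fun r => (r.1, att s r.2 A)) =
      rootedSum L tr l * (algebraMap 𝔸 R (total L tr A) + ((s : ℤ) : R) * L (rooted L tr A)) := by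
  induction l with
  | nil => simp [rootedSum]
  | cons r l ih =>
    have h : ∀ r l, rootedSum L tr (r :: l) =
      total L tr r.1 • rooted L tr r.2 + rootedSum L tr l := fun r l => by simp [rootedSum]
    rw [List.map_cons, h, h, ih, add_mul, smul_mul_assoc, rooted, total, zsmul_eq_mul, total]

lemma rootedSum_map_right (s : ℤˣ) (A : SignedTree) (l : List (SignedTree × SignedTree)) :
    rootedSum L tr (l.map fun r => (r.1, att s A r.2)) =
      rooted L tr A * (algebraMap 𝔸 R (tr (rootedSum L tr l)) +
        ((s : ℤ) : R) * L (rootedSum L tr l)) := by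
  induction l with
  | nil => simp [rootedSum]
  | cons r l ih =>
    have h : ∀ r l, rootedSum L tr (r :: l) =
      total L tr r.1 • rooted L tr r.2 + rootedSum L tr l := fun r l => by simp [rootedSum]
    rw [List.map_cons, h, h, ih, rooted, zsmul_eq_mul]
    simp only [map_add, map_smul, smul_eq_mul, map_mul]
    simp only [Algebra.smul_def]
    ring

lemma exists_neg_one_pow (n : ℕ) : ∃ k : ℤ, (-1) ^ n = 1 - 2 * (n : ℤ) + 4 * k := by
  induction n with
  | zero => exact ⟨0, by simp⟩
  | succ n ih =>
    obtain ⟨k, hk⟩ := ih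
    exact ⟨n - k, by rw [pow_succ, hk]; push_cast; ring⟩

/-- Modulo four, the generating functions of signed trees of the same shape differ by the sum of
the generating functions of the parts. -/
lemma SameShape.rooted_eq_add {A B : SignedTree} (h : SameShape A B) :
    ∃ z, rooted L tr B =
      (-1) ^ (diff A B).length * rooted L tr A + 2 * rootedSum L tr (diff A B) + 4 * z := by
  induction h with
  | pt => exact ⟨0, by simp [diff, rootedSum]⟩
  | @att A₁ B₁ A₂ B₂ s s' _ _ ih1 ih2 =>
    obtain ⟨z₁, h1⟩ := ih1
    obtain ⟨z₂, h2⟩ := ih2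
    have hneg : ∀ n : ℕ, ∃ k : R, (-1) ^ n = 1 + 2 * k := by
      intro n
      obtain ⟨k, hk⟩ := exists_neg_one_pow n
      refine ⟨((2 * k - n : ℤ) : R), ?_⟩
      have := congrArg (Int.cast : ℤ → R) hk
      push_cast at this ⊢
      rw [this]; ring
    obtain ⟨k₁, hk₁⟩ := hneg (diff A₁ B₁).length
    obtain ⟨k₂, hk₂⟩ := hneg (diff A₂ B₂).length
    have hmul : ∀ (n : ℕ) (x : R), (-1) ^ n * x = ((-1) ^ n : ℤ) • x := by
      intro n x; simp
    have htr := congrArg (fun x => algebraMap 𝔸 R (tr x)) h2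
    have hL := congrArg L h2
    have h4 : ∀ x : R, 4 * x = (4 : ℤ) • x := fun x => by simp
    have h2' : ∀ x : R, 2 * x = (2 : ℤ) • x := fun x => by simp
    rw [hmul, h4, h2'] at hL htr
    simp only [map_add, map_zsmul] at hL htr
    rw [← hmul, ← h4, ← h2', hk₂] at hL htr
    rw [hk₁] at h1
    have hsingle : rootedSum L tr [(A₂, A₁)] =
        algebraMap 𝔸 R (tr (rooted L tr A₂)) * rooted L tr A₁ := by
      simp [rootedSum, Algebra.smul_def, total]
    have hnil : rootedSum L tr [] = 0 := rfl
    rw [rooted, zsmul_eq_mul, hL, htr, h1, rooted, zsmul_eq_mul, diff, rootedSum_append,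
      rootedSum_append, rootedSum_map_left, rootedSum_map_right, List.length_append,
      List.length_append, List.length_map, List.length_map, pow_add, pow_add, hk₁, hk₂, total]
    generalize rooted L tr A₁ = a at hsingle ⊢
    generalize algebraMap 𝔸 R (tr (rooted L tr A₂)) = t at hsingle ⊢
    generalize L (rooted L tr A₂) = l
    generalize rootedSum L tr (diff A₁ B₁) = S
    generalize algebraMap 𝔸 R (tr (rootedSum L tr (diff A₂ B₂))) = σ
    generalize L (rootedSum L tr (diff A₂ B₂)) = ρ
    generalize algebraMap 𝔸 R (tr z₂) = ζ
    generalize L z₂ = η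
    by_cases hs : s = s'
    · subst hs
      simp only [if_true, hnil, List.length_nil, pow_zero]
      generalize ((s : ℤ) : R) = c
      exact ⟨k₂ * S * (t + c * l) + k₁ * a * (σ + c * ρ) + S * (σ + c * ρ) +
        z₁ * ((1 + 2 * k₂) * (t + c * l) + 2 * (σ + c * ρ) + 4 * (ζ + c * η)) +
        (ζ + c * η) * ((1 + 2 * k₁) * a + 2 * S), by ring⟩
    -- For a signed kept part `u`, reversal turns `t + u` into `t - u = -(t + u) + 2 * t`; the extra
    -- `2 * t * a` is what cutting this edge contributes.
    · rw [if_neg hs, hsingle, Int.units_ne_iff_eq_neg.1 hs, List.length_singleton, pow_one]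
      simp only [Units.val_neg, Int.cast_neg]
      generalize ((s' : ℤ) : R) = c
      exact ⟨(k₁ + k₂ + 2 * k₁ * k₂) * a * t + S * (-(1 + k₂) * (t - c * l) + t + 2 * k₂ * t) +
        (c * ρ + k₁ * (σ + c * ρ)) * a + S * (σ + c * ρ) +
        z₁ * ((1 + 2 * k₂) * (t + c * l) + 2 * (σ + c * ρ) + 4 * (ζ + c * η)) +
        (ζ + c * η) * ((1 + 2 * k₁) * a + 2 * S), by ring⟩

/-- If the generating function of a tree that is symmetric up to signs is trivial, then those of the
parts multiply to one modulo two, on average. -/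
lemma SameShape.exists_sum_eq_two_mul (hs : IsSkew L tr) (h2 : ∀ x : 𝔸, 2 * x = 0 → x = 0)
    {A B : SignedTree} (h : SameShape A B) {s : ℤˣ} (hA : ∃ q, total L tr A = 1 + 2 * q)
    (ht : total L tr (SignedTree.att s A B) = 1) :
    ∃ y, ((diff A B).map fun r => total L tr r.1 * total L tr (SignedTree.att s A r.2) - 1).sum = 2 * y := by
  obtain ⟨z, hz⟩ := h.rooted_eq_add (L := L) (tr := tr)
  obtain ⟨q, hq⟩ := hA
  obtain ⟨k, hk⟩ := exists_neg_one_pow (diff A B).length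
  set S := rootedSum L tr (diff A B) with hS
  have hsum : ∀ l : List (SignedTree × SignedTree),
      (l.map fun r => total L tr r.1 * total L tr (SignedTree.att s A r.2) - 1).sum =
        total L tr A * tr (rootedSum L tr l) +
          ((s : ℤ) : 𝔸) * tr (rooted L tr A * L (rootedSum L tr l)) - (l.length : 𝔸) := by
    intro l
    induction l with
    | nil => simp [rootedSum]
    | cons r l ih =>
      have h : rootedSum L tr (r :: l) =
        total L tr r.1 • rooted L tr r.2 + rootedSum L tr l := by simp [rootedSum]
      rw [List.map_cons, List.sum_cons, ih, h, total_att, zsmul_eq_mul]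
      simp only [map_add, map_smul, smul_eq_mul, mul_add, mul_smul_comm, List.length_cons]
      push_cast
      rw [total, total, total]
      ring
  have hz' : rooted L tr B = ((-1) ^ (diff A B).length : ℤ) • rooted L tr A + (2 : ℤ) • S +
      (4 : ℤ) • z := by
    rw [hz]; simp
  have e1 : total L tr B = ((-1) ^ (diff A B).length : ℤ) * total L tr A + 2 * tr S + 4 * tr z := by
    rw [total, hz']
    simp only [map_add, map_zsmul]
    simp only [zsmul_eq_mul, total]
    push_cast
    ring
  have e2 : tr (rooted L tr A * L (rooted L tr B)) =
      2 * tr (rooted L tr A * L S) + 4 * tr (rooted L tr A * L z) := by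
    rw [hz']
    simp only [map_add, map_zsmul, mul_add, mul_smul_comm, hs.alt, smul_zero, zero_add]
    simp only [zsmul_eq_mul]
    push_cast
    ring
  rw [total_att, e1, e2, hq, hk, zsmul_eq_mul] at ht
  rw [hsum, ← hS, hq]
  push_cast at ht ⊢
  generalize tr S = a at *
  generalize tr (rooted L tr A * L S) = b at *
  generalize tr z = c at *
  generalize tr (rooted L tr A * L z) = d at *
  generalize ((s : ℤ) : 𝔸) = e at *
  generalize ((diff A B).length : 𝔸) = n at *
  -- Collecting the multiples of four in the witness makes `ht` twice the claim: the square of `1 +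
  -- 2 * q` is `1` modulo four, and `hs.alt` has removed the pairing of `A` with itself.
  refine ⟨-((1 - 2 * n + 4 * k) * (q + q ^ 2) + k + (1 + 2 * q) * c + e * d), ?_⟩
  apply sub_eq_zero.1
  apply h2
  linear_combination ht

end algebra

lemma exists_max_image {α : Type*} (l : List α) (hl : l ≠ []) (f : α → ℕ) :
    ∃ a ∈ l, ∀ b ∈ l, f b ≤ f a := by
  classical
  obtain ⟨a, ha, h⟩ := l.toFinset.exists_max_image f
    (by rwa [List.toFinset_nonempty_iff])
  exact ⟨a, List.mem_toFinset.1 ha, fun b hb => h b (List.mem_toFinset.2 hb)⟩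

/-- Such a tree has room for at most one copy of `N`, and only as the whole tree. -/
lemma testTotal_core {t : SignedTree} {N : ℕ+} (hN : N ≠ 1) (h : size t.code ≤ size N) :
    testTotal (ZMod 2) N t =
      if (canonicalForm t.code).1 ≠ 0 ∧ (canonicalForm t.code).2 = N then 1 + X else 1 := by
  have hpos := size_pos N
  have hd : (testTotal (ZMod 2) N t).natDegree ≤ 1 := by
    have := natDegree_testTotal (𝔸 := ZMod 2) (N := N) t
    exact Nat.le_of_mul_le_mul_right (by omega) hpos
  have h0 := coeff_zero_testTotal (ZMod 2) (N := N) t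
  rw [eq_X_add_C_of_natDegree_le_one hd, h0]
  by_cases hs : size t.code = size N
  · rw [coeff_one_testTotal hN hs]
    split_ifs
    · simp [add_comm]
    · simp
  · have h1 : (testTotal (ZMod 2) N t).coeff 1 = 0 := by
      apply coeff_eq_zero_of_natDegree_lt
      have := natDegree_testTotal (𝔸 := ZMod 2) (N := N) t
      by_contra h
      have := Nat.mul_le_mul_right (size N) (not_lt.1 h)
      omega
    rw [h1, if_neg]
    · simp
    · rintro ⟨-, h2⟩
      apply hs
      rw [← h2, size_canonicalForm]

/-- The parts of a rigid tree are not balanced modulo two. -/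
lemma diff_eq_nil {A B : SignedTree} {s : ℤˣ} (hrig : Rigid A.code) {m : ℕ}
    (hm : size A.code = 2 ^ m)
    (h : ∀ N, N ≠ 1 → canonicalForm N = (1, N) →
      ((diff A B).map fun r => testTotal (ZMod 2) N r.1 *
        testTotal (ZMod 2) N (att s A r.2) - 1).sum = 0) : diff A B = [] := by
  by_contra hne
  choose core j hsize hsign hj0 hj hpow using exists_core
  -- Join `A` to each rest and test against the largest core that arises; every core then
  -- contributes `1 + X` or `1`.
  obtain ⟨r₀, hr₀, hmax⟩ := exists_max_image _ hne fun r => size (core (att s A r.2)).code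
  set t₀ := core (att s A r₀.2) with ht₀
  set N := (canonicalForm t₀.code).2 with hN
  have hNs : size N = size t₀.code := size_canonicalForm _
  have hNc : canonicalForm N = (1, N) := canonicalForm_canonicalForm (hsign _)
  set k := j (att s A r₀.2) with hk
  have hD : ∀ r : SignedTree × SignedTree, size A.code + size r.2.code =
      2 ^ j (att s A r.2) * size (core (att s A r.2)).code := by
    intro r; rw [← hsize, size_code_att]
  have hD₀ : size A.code + size r₀.2.code = 2 ^ k * size N := by rw [hNs]; exact hD r₀
  have hQ : ∀ r ∈ diff A B, 0 < size r.2.code ∧ size r.2.code < size A.code := fun r hr =>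
    ⟨size_pos _, size_lt_of_mem_diff hr⟩
  have hNpos := size_pos N
  -- The sizes of the joined trees lie strictly between `size A.code` and twice that, so equal core
  -- sizes force equal exponents.
  have hpowlt : ∀ r ∈ diff A B, size (core (att s A r.2)).code = size N →
      j (att s A r.2) = k := by
    intro r hr he
    have h1 := hD r
    rw [he] at h1
    have h2 := hQ r hr
    have h3 := hQ r₀ hr₀
    have e1 : ∀ a b : ℕ, 2 ^ a * size N < 2 * size A.code → size A.code < 2 ^ b * size N →
        a ≤ b := by
      intro a b h4 h5
      by_contra! hlt
      have h6 : 2 ^ (b + 1) ≤ 2 ^ a := Nat.pow_le_pow_right two_pos hlt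
      have := Nat.mul_le_mul_right (size N) h6
      rw [pow_succ] at this
      nlinarith
    exact le_antisymm (e1 _ _ (by omega) (by omega)) (e1 _ _ (by omega) (by omega))
  -- A core with one vertex would put a power of two strictly between `2 ^ m` and `2 ^ (m + 1)`.
  have hN1 : N ≠ 1 := by
    intro h1
    rw [h1, size_one, mul_one, hm] at hD₀
    have h3 := hQ r₀ hr₀
    rw [hm] at h3
    have h4 : m < k := (Nat.pow_lt_pow_iff_right (by norm_num : 1 < 2)).1 (by omega)
    have h5 : 2 ^ (m + 1) ≤ 2 ^ k := Nat.pow_le_pow_right two_pos h4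
    rw [pow_succ] at h5
    omega
  have hcoeff : ∀ r ∈ diff A B, (testTotal (ZMod 2) N r.1 *
      testTotal (ZMod 2) N (att s A r.2) - 1).coeff (2 ^ k) =
        if r.2.code = r₀.2.code then 1 else 0 := by
    intro r hr
    -- The branch cut off is smaller than `A`, hence smaller than `2 ^ k` copies of `N`.
    have hC : (testTotal (ZMod 2) N r.1).coeff (2 ^ k) = 0 := by
      apply coeff_eq_zero_of_natDegree_lt
      have h1 := natDegree_testTotal (𝔸 := ZMod 2) (N := N) r.1
      have h2 := size_of_mem_diff hr
      have h3 := hQ r hr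
      have h4 := hQ r₀ hr₀
      exact Nat.lt_of_mul_lt_mul_right (a := size N) (by omega)
    have hk0 : 2 ^ k ≠ 0 := (pow_pos two_pos k).ne'
    have hone : (1 : (ZMod 2)[X]).coeff (2 ^ k) = 0 := by
      rw [coeff_one, if_neg hk0]
    have hle : size (core (att s A r.2)).code ≤ size N := by rw [hNs]; exact hmax r hr
    rw [hpow (att s A r.2), testTotal_core hN1 hle]
    by_cases hc : (canonicalForm (core (att s A r.2)).code).2 = N
    · have hjk : j (att s A r.2) = k := hpowlt r hr (by rw [← hc, size_canonicalForm])
      -- For `k = 0` both trees are their own cores and share a canonical form; for `k ≠ 0` both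
      -- flip an edge. Either way `branch_unique` identifies the rests.
      have hQQ : r.2.code = r₀.2.code := by
        have h1 := hD r
        rw [hjk, ← size_canonicalForm (core _).code, hc, ← hD₀] at h1
        apply branch_unique (x := A.code) (hQ r hr).2 (by omega)
        by_cases hz : k = 0
        · right
          have e1 := hj0 (att s A r.2) (hjk.trans hz)
          have e2 := hj0 (att s A r₀.2) hz
          have f1 := hsign (att s A r.2)
          have f2 := hsign (att s A r₀.2)
          rw [← ht₀] at e2 f2
          rw [e1] at f1 hc
          rw [hN, e2] at hc
          rw [e2] at f2
          exact ⟨f1, f2, hc⟩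
        · left
          exact ⟨hj (att s A r.2) (by rw [hjk]; exact hz), hj (att s A r₀.2) hz⟩
      rw [if_pos ⟨hsign _, hc⟩, if_pos hQQ, hjk]
      have : Fact (Nat.Prime 2) := ⟨Nat.prime_two⟩
      -- As `(1 + X) ^ 2 ^ k = 1 + X ^ 2 ^ k` here, the coefficient is the constant term `1` of the
      -- branch.
      rw [add_pow_char_pow, one_pow, mul_add, mul_one, coeff_sub, coeff_add, hC, hone]
      have := coeff_mul_X_pow (testTotal (ZMod 2) N r.1) (2 ^ k) 0
      rw [zero_add] at this
      rw [this, coeff_zero_testTotal]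
      ring
    · rw [if_neg fun h => hc h.2, one_pow, mul_one, coeff_sub, hC, hone, if_neg, sub_zero]
      intro he
      have := List.inj_on_of_nodup_map (nodup_diff hrig) hr hr₀ he
      rw [this] at hc
      exact hc rfl
  have h1 := congrArg (fun p => p.coeff (2 ^ k)) (h N hN1 hNc)
  simp only [coeff_zero] at h1
  have h2 : ∀ l : List (ZMod 2)[X], l.sum.coeff (2 ^ k) = (l.map fun p => p.coeff (2 ^ k)).sum := by
    intro l
    induction l with
    | nil => simp
    | cons p l ih => simp [ih]
  rw [h2, List.map_map] at h1
  replace h1 := (congrArg List.sum (List.map_congr_left hcoeff)).symm.trans h1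
  have h3 : ∀ (l : List (SignedTree × SignedTree)) (q : ℕ+),
      (l.map fun r => if r.2.code = q then (1 : ZMod 2) else 0).sum =
        ((l.map fun r => r.2.code).count q : ZMod 2) := by
    intro l q
    induction l with
    | nil => simp
    | cons r l ih =>
      rw [List.map_cons, List.sum_cons, ih, List.map_cons, List.count_cons]
      by_cases h : r.2.code = q <;> simp [h, add_comm]
  -- By rigidity the code of `r₀.2` occurs exactly once, so the sum is `1` and not `0`.
  rw [h3, List.count_eq_one_of_mem (nodup_diff hrig) (List.mem_map_of_mem hr₀)] at h1
  simp at h1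

/-- The trees obtained by repeatedly joining two copies of a tree at corresponding vertices. -/
inductive Mirrored : SignedTree → Prop
  | pt : Mirrored pt
  | double (s A) : Mirrored A → Mirrored (att s A A)
  | of_equiv {A B} : TreeEquiv A B → Mirrored B → Mirrored A

/-- A signed tree with trivial generating functions is mirrored. -/
theorem mirrored_of_testTotal_eq_one {t : SignedTree}
    (h : ∀ N, N ≠ 1 → canonicalForm N = (1, N) → testTotal ℤ N t = 1) : Mirrored t := by
  induction hn : size t.code using Nat.strong_induction_on generalizing t with
  | _ n ih =>
    by_cases ht : 2 ≤ size t.code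
    · have hmod : ∀ {N t}, testTotal ℤ N t = 1 → testTotal (ZMod 2) N t = 1 := by
        intro N t h
        rw [← testTotal_map (Int.castRingHom (ZMod 2)), h, Polynomial.map_one]
      obtain ⟨s, A, B, h1, h2, h3, -⟩ :=
        exists_double_of_trivialModTwo (fun N hN hc => hmod (h N hN hc)) ht
      obtain ⟨hrig, m, hm⟩ := h3.rigid
      obtain ⟨B', h4, h5⟩ := exists_sameShape_of_code_eq h2
      have h6 : TreeEquiv t (att s A B') := h1.trans (.of_root (.congr s (.refl A) h4))
      have hcast : ∀ p : ℤ[X], p.map (Int.castRingHom (ZMod 2)) = 0 → ∃ q, p = 2 * q := by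
        intro p hp
        have : C (2 : ℤ) ∣ p := by
          rw [C_dvd_iff_dvd_coeff]
          intro i
          have := congrArg (fun p => p.coeff i) hp
          simp only [coeff_map, coeff_zero, eq_intCast] at this
          exact (ZMod.intCast_zmod_eq_zero_iff_dvd _ 2).1 this
        obtain ⟨q, hq⟩ := this
        exact ⟨q, by rw [hq, C_ofNat]⟩
      have htot : ∀ N, testTotal ℤ N t = testTotal ℤ N (att s A B') := fun N =>
        h6.total_eq (isSkew_testWeight ℤ N)
      have hdiff : diff A B' = [] := by
        apply diff_eq_nil (s := s) hrig hm
        intro N hN hc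
        obtain ⟨q, hq⟩ := hcast (testTotal ℤ N A - 1) (by
          rw [Polynomial.map_sub, testTotal_map, h3 N hN hc, Polynomial.map_one, sub_self])
        have h7 := h N hN hc
        rw [htot] at h7
        obtain ⟨y, hy⟩ := h5.exists_sum_eq_two_mul (isSkew_testWeight ℤ N)
          (fun x hx => (mul_eq_zero.1 hx).resolve_left two_ne_zero) (s := s)
          ⟨q, by rw [← hq]; exact (add_sub_cancel _ _).symm⟩ h7
        have h8 := congrArg (Polynomial.mapRingHom (Int.castRingHom (ZMod 2))) hy
        rw [map_list_sum, List.map_map, map_mul, map_ofNat, two_eq_zero_zmod, zero_mul] at h8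
        rw [← h8]
        congr 1
        refine List.map_congr_left fun r _ => ?_
        rw [← testTotal_map (Int.castRingHom (ZMod 2)), ← testTotal_map (Int.castRingHom (ZMod 2))]
        simp only [Function.comp, map_sub, map_mul, map_one]
        rfl
      have h9 := h5.eq_of_diff hdiff
      subst h9
      refine .of_equiv h6 (.double s A (ih _ ?_ (fun N hN hc => ?_) rfl))
      · have h10 := h6.size_eq
        rw [size_code_att] at h10
        have := size_pos A.code
        omega
      · have h10 := h N hN hc
        rw [htot, testTotal, formalTotal, total_att_self (isSkew_testWeight ℤ N)] at h10
        -- The constant coefficient `1` excludes the square root `-1`.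
        rcases sq_eq_one_iff.1 h10 with h11 | h11
        · exact h11
        · have h12 := coeff_zero_testTotal ℤ (N := N) A
          rw [testTotal, formalTotal, h11] at h12
          simp at h12
    · have h1 := eq_one_of_size_le_one (n := t.code) (by omega)
      rw [eq_pt_of_code_eq_one h1]
      exact .pt

end SignedTree

universe v

namespace SignedTree

/-! ### Realizations of signed trees -/

/-- The vertices of a signed tree. -/
def Vert : SignedTree → Type v
  | pt => PUnit
  | att _ A B => Vert A ⊕ Vert B

/-- The root of a signed tree. -/
def root : ∀ t : SignedTree, Vert.{v} t
  | pt => PUnit.unit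
  | att _ A _ => Sum.inl (root A)

/-- The adjacency relation of a signed tree. -/
def Arc : ∀ t : SignedTree, Vert.{v} t → Vert.{v} t → Prop
  | pt, _, _ => False
  | att _ A _, Sum.inl u, Sum.inl v => Arc A u v
  | att _ _ B, Sum.inr u, Sum.inr v => Arc B u v
  | att s A B, Sum.inl u, Sum.inr v => s = 1 ∧ u = root A ∧ v = root B
  | att s A B, Sum.inr u, Sum.inl v => s = -1 ∧ v = root A ∧ u = root B

/-- The digraph of a signed tree. -/
def toDigraph (t : SignedTree) : Digraph (Vert.{v} t) where
  Adj := Arc t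

noncomputable instance instFintypeVert : ∀ t : SignedTree, Fintype (Vert.{v} t)
  | pt => inferInstanceAs (Fintype PUnit)
  | att _ A B =>
    have := instFintypeVert A
    have := instFintypeVert B
    inferInstanceAs (Fintype (Vert A ⊕ Vert B))

noncomputable instance instDecidableEqVert (t : SignedTree) : DecidableEq (Vert.{v} t) :=
  Classical.decEq _

lemma RootEquiv.exists_iso {A B : SignedTree} (h : RootEquiv A B) :
    ∃ e : Arc.{v} A ≃r Arc.{v} B, e (root A) = root B := by
  induction h with
  | refl => exact ⟨RelIso.refl _, rfl⟩
  | trans _ _ ih1 ih2 =>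
    obtain ⟨e1, h1⟩ := ih1
    obtain ⟨e2, h2⟩ := ih2
    exact ⟨e1.trans e2, by rw [RelIso.trans_apply, h1, h2]⟩
  | comm s s' A B C =>
    let e : Vert.{v} (att s (att s' A B) C) ≃ Vert.{v} (att s' (att s A C) B) :=
      (Equiv.sumAssoc (Vert A) (Vert B) (Vert C)).trans
        (((Equiv.refl (Vert A)).sumCongr (Equiv.sumComm (Vert B) (Vert C))).trans
          (Equiv.sumAssoc (Vert A) (Vert C) (Vert B)).symm)
    refine ⟨⟨e, ?_⟩, rfl⟩
    rintro ((a | a) | a) ((b | b) | b) <;>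
      first
      | exact Iff.rfl
      | exact and_congr_right fun _ => and_congr_left fun _ => Sum.inl_injective.eq_iff
      | exact and_congr_right fun _ => and_congr_left fun _ => Sum.inl_injective.eq_iff.symm
      | exact iff_of_false (fun h => Sum.inr_ne_inl h.2.1) (fun h => Sum.inr_ne_inl h.2.1)
  | @congr A A' B B' s _ _ ih1 ih2 =>
    obtain ⟨e1, h1⟩ := ih1
    obtain ⟨e2, h2⟩ := ih2
    let e : Vert.{v} (att s A B) ≃ Vert.{v} (att s A' B') := e1.toEquiv.sumCongr e2.toEquiv
    refine ⟨⟨e, ?_⟩, congrArg Sum.inl h1⟩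
    have hA : ∀ a, e1 a = root A' ↔ a = root A := fun a => by rw [← h1]; exact e1.injective.eq_iff
    have hB : ∀ b, e2 b = root B' ↔ b = root B := fun b => by rw [← h2]; exact e2.injective.eq_iff
    rintro (a | a) (b | b)
    · exact e1.map_rel_iff
    · exact and_congr_right fun _ => and_congr (hA a) (hB b)
    · exact and_congr_right fun _ => and_congr (hA b) (hB a)
    · exact e2.map_rel_iff

lemma nonempty_swap_iso (s : ℤˣ) (A B : SignedTree) :
    Nonempty (Arc.{v} (att s A B) ≃r Arc.{v} (att (-s) B A)) := by
  let e : Vert.{v} (att s A B) ≃ Vert.{v} (att (-s) B A) := Equiv.sumComm (Vert A) (Vert B)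
  refine ⟨⟨e, ?_⟩⟩
  rintro (a | a) (b | b)
  · exact Iff.rfl
  · exact and_congr neg_inj and_comm
  · exact and_congr neg_eq_iff_eq_neg and_comm
  · exact Iff.rfl

lemma TreeEquiv.nonempty_iso {A B : SignedTree} (h : TreeEquiv A B) :
    Nonempty (Arc.{v} A ≃r Arc.{v} B) := by
  induction h with
  | of_root h => exact ⟨h.exists_iso.choose⟩
  | trans _ _ ih1 ih2 => exact ⟨ih1.some.trans ih2.some⟩
  | swap s A B => exact nonempty_swap_iso s A B

/-- The digraph of a mirrored signed tree is recursively bridge-mirrored. -/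
lemma Mirrored.recursivelyBridgeMirrored {t : SignedTree} (h : Mirrored t) :
    (toDigraph.{v} t).RecursivelyBridgeMirrored := by
  induction h with
  | pt => exact .iso _ _ .single ⟨RelIso.mk (Equiv.refl PUnit) Iff.rfl⟩
  | double s A _ ih =>
    have h1 : (toDigraph.{v} (att 1 A A)).RecursivelyBridgeMirrored := by
      refine .iso _ _ (.double _ (root A) ih) ⟨RelIso.mk (Equiv.refl (Vert A ⊕ Vert A)) ?_⟩
      rintro (a | a) (b | b)
      · exact Iff.rfl
      · exact ⟨And.right, fun h => ⟨rfl, h⟩⟩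
      · exact iff_of_false (fun h => absurd h.1 (by decide)) id
      · exact Iff.rfl
    rcases Int.units_eq_one_or s with rfl | rfl
    · exact h1
    · exact .iso _ _ h1 (nonempty_swap_iso 1 A A)
  | of_equiv h _ ih => exact .iso _ _ ih ⟨h.nonempty_iso.some.symm⟩

/-- Every oriented tree is the digraph of a signed tree, with a given root. -/
lemma exists_iso_of_isTree (n : ℕ) {V : Type v} [Finite V] (hn : Nat.card V = n) (H : Digraph V)
    (ho : H.IsOriented) (ht : H.toSimpleGraphInclusive.IsTree) (r : V) :
    ∃ (t : SignedTree) (e : Arc.{v} t ≃r H.Adj), e (root t) = r := by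
  induction n using Nat.strong_induction_on generalizing V with
  | _ n ih =>
    have hloop : ∀ u, ¬ H.Adj u u := fun u h => ho u u h h
    by_cases hsub : ∀ p, p = r
    · have : Unique V := ⟨⟨r⟩, hsub⟩
      refine ⟨pt, RelIso.mk (Equiv.ofUnique PUnit V) ?_, hsub _⟩
      intro a b
      have h : ∀ x y, ¬ H.Adj x y := fun x y => by rw [hsub x, hsub y]; exact hloop r
      exact iff_of_false (h _ _) id
    push Not at hsub
    set G := H.toSimpleGraphInclusive with hG
    -- Remove an edge at `r`: it is a bridge, and both sides are smaller trees, rooted at its ends.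
    obtain ⟨p, hp⟩ : ∃ p, G.Adj r p := by
      obtain ⟨q, hq⟩ := hsub
      have : Nontrivial V := ⟨q, r, hq⟩
      exact ht.connected.preconnected.exists_adj_of_nontrivial r
    set G' := G.deleteEdges {s(r, p)} with hG'
    have hb : ¬ G'.Reachable r p :=
      SimpleGraph.isAcyclic_iff_forall_adj_isBridge.1 ht.isAcyclic hp
    have hG'adj : ∀ {u v}, G.Adj u v → s(u, v) ≠ s(r, p) → G'.Adj u v := by
      intro u v h1 h2
      rw [hG', SimpleGraph.deleteEdges_adj]
      exact ⟨h1, h2⟩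
    have hcover : ∀ v, G'.Reachable r v ∨ G'.Reachable p v := by
      intro v
      have h := (SimpleGraph.reachable_iff_reflTransGen r v).1 (ht.connected.preconnected r v)
      induction h with
      | refl => exact Or.inl (SimpleGraph.Reachable.refl _)
      | @tail u w _ h ih =>
        by_cases he : s(u, w) = s(r, p)
        · rcases Sym2.eq_iff.1 he with ⟨-, rfl⟩ | ⟨-, rfl⟩
          · exact Or.inr (SimpleGraph.Reachable.refl _)
          · exact Or.inl (SimpleGraph.Reachable.refl _)
        · have h' := (hG'adj h he).reachable
          exact ih.imp (fun h => h.trans h') fun h => h.trans h'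
    have key : ∀ q : V, (∃ x, ¬ G'.Reachable q x) →
        ∃ (t : SignedTree) (e : Arc.{v} t ≃r fun a b : {x // G'.Reachable q x} => H.Adj a b),
          (e (root t) : V) = q := by
      rintro q ⟨x, hx⟩
      let S : Set V := {x | G'.Reachable q x}
      let K : Digraph {x // G'.Reachable q x} := ⟨fun a b => H.Adj a b⟩
      have hK : K.toSimpleGraphInclusive = G.induce S := by
        ext a b
        simp [Digraph.toSimpleGraphInclusive, K, hG, S, Subtype.ext_iff]
      have hconn : K.toSimpleGraphInclusive.Connected := by
        rw [hK]
        have h1 := (G'.connectedComponentMk q).connected_toSimpleGraph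
        have h2 : (G'.connectedComponentMk q).supp = S := by
          ext y
          simp [S, SimpleGraph.reachable_comm]
        have h3 : (G'.induce S).Connected := by
          rw [← h2]; exact h1
        exact h3.mono (SimpleGraph.comap_monotone _ (SimpleGraph.deleteEdges_le _))
      have hcard : Nat.card {x // G'.Reachable q x} < n := by
        rw [← hn]
        exact Finite.card_subtype_lt hx
      obtain ⟨t, e, he⟩ := ih _ hcard rfl K (fun u v => ho u v)
        ⟨hconn, by rw [hK]; exact ht.isAcyclic.induce S⟩ ⟨q, SimpleGraph.Reachable.refl _⟩
      exact ⟨t, e, congrArg Subtype.val he⟩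
    obtain ⟨A, eA, hA⟩ := key r ⟨p, hb⟩
    obtain ⟨B, eB, hB⟩ := key p ⟨r, fun h => hb h.symm⟩
    have hdisj : ∀ {x}, G'.Reachable r x → G'.Reachable p x → False :=
      fun h1 h2 => hb (h1.trans h2.symm)
    have hcross : ∀ {u v}, G'.Reachable r u → G'.Reachable p v → G.Adj u v → u = r ∧ v = p := by
      intro u v hu hv h
      by_cases he : s(u, v) = s(r, p)
      · rcases Sym2.eq_iff.1 he with h1 | ⟨rfl, rfl⟩
        · exact h1
        · exact (hdisj (SimpleGraph.Reachable.refl _) hv).elim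
      · exact (hdisj (hu.trans (hG'adj h he).reachable) hv).elim
    have hadj : ∀ {u v}, H.Adj u v → G.Adj u v := fun {u v} h =>
      ⟨fun he => hloop v (he ▸ h), Or.inl h⟩
    let s : ℤˣ := open Classical in if H.Adj r p then 1 else -1
    have hs1 : s = 1 ↔ H.Adj r p := by
      simp only [s]; split_ifs with h <;> simp [h]
    have hs2 : s = -1 ↔ H.Adj p r := by
      simp only [s]; split_ifs with h
      · simpa using ho _ _ h
      · simpa using hp.2.resolve_left h
    let φ : Vert.{v} A ⊕ Vert.{v} B → V := Sum.elim (fun a => (eA a).1) (fun b => (eB b).1)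
    have hφ : Function.Bijective φ := by
      constructor
      · rintro (a | a) (b | b) h
        · exact congrArg Sum.inl (eA.injective (Subtype.ext h))
        · have h : (eA a).1 = (eB b).1 := h
          exact (hdisj (eA a).2 (h ▸ (eB b).2)).elim
        · have h : (eB a).1 = (eA b).1 := h
          exact (hdisj (eA b).2 (h ▸ (eB a).2)).elim
        · exact congrArg Sum.inr (eB.injective (Subtype.ext h))
      · intro x
        rcases hcover x with h | h
        · obtain ⟨a, ha⟩ := eA.surjective ⟨x, h⟩
          exact ⟨Sum.inl a, congrArg Subtype.val ha⟩
        · obtain ⟨a, ha⟩ := eB.surjective ⟨x, h⟩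
          exact ⟨Sum.inr a, congrArg Subtype.val ha⟩
    have hrA : ∀ a, (eA a).1 = r ↔ a = root A := fun a =>
      ⟨fun h => eA.injective (Subtype.ext (h.trans hA.symm)), fun h => h ▸ hA⟩
    have hrB : ∀ b, (eB b).1 = p ↔ b = root B := fun b =>
      ⟨fun h => eB.injective (Subtype.ext (h.trans hB.symm)), fun h => h ▸ hB⟩
    refine ⟨att s A B, RelIso.mk (Equiv.ofBijective φ hφ) ?_, hA⟩
    rintro (a | a) (b | b)
    · exact eA.map_rel_iff
    · change H.Adj (eA a) (eB b) ↔ s = 1 ∧ a = root A ∧ b = root B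
      rw [hs1, ← hrA, ← hrB]
      constructor
      · intro h
        obtain ⟨h1, h2⟩ := hcross (eA a).2 (eB b).2 (hadj h)
        exact ⟨by rwa [h1, h2] at h, h1, h2⟩
      · rintro ⟨h, h1, h2⟩
        rwa [h1, h2]
    · change H.Adj (eB a) (eA b) ↔ s = -1 ∧ b = root A ∧ a = root B
      rw [hs2, ← hrA, ← hrB]
      constructor
      · intro h
        obtain ⟨h1, h2⟩ := hcross (eA b).2 (eB a).2 (hadj h).symm
        exact ⟨by rwa [h1, h2] at h, h1, h2⟩
      · rintro ⟨h, h1, h2⟩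
        rwa [h1, h2]
    · exact eB.map_rel_iff

end SignedTree

namespace Digraph

/-! ### Homomorphism polynomials -/

variable {V W : Type*} [Fintype V] [Fintype W]

/-- The element `a` if `p` holds, and `1` otherwise. -/
noncomputable def factor {R : Type*} [CommRing R] (p : Prop) (a : R) : R :=
  open Classical in if p then a else 1

/-- The contribution of a map to the homomorphism polynomial of a digraph. -/
noncomputable def arcProd {X R : Type*} [CommRing R] (H : Digraph V) (f : X → X → R) (χ : V → X) : R :=
  ∏ u, ∏ v, factor (H.Adj u v) (1 + f (χ u) (χ v))

lemma arcProd_congr {X R : Type*} [CommRing R] {H : Digraph V} {K : Digraph W} (e : H.Adj ≃r K.Adj)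
    (f : X → X → R) (χ : W → X) : H.arcProd f (χ ∘ e) = K.arcProd f χ := by
  rw [arcProd, arcProd]
  refine Fintype.prod_equiv e.toEquiv _ _ fun u => Fintype.prod_equiv e.toEquiv _ _ fun v => ?_
  rw [← propext (e.map_rel_iff (a := u) (b := v))]
  rfl

lemma sum_arcProd_congr [DecidableEq V] [DecidableEq W] {X R : Type*} [Fintype X] [CommRing R]
    {H : Digraph V} {K : Digraph W} (e : H.Adj ≃r K.Adj) (f : X → X → R) (w : X → R) :
    ∑ χ : V → X, (∏ u, w (χ u)) * H.arcProd f χ =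
      ∑ χ : W → X, (∏ u, w (χ u)) * K.arcProd f χ := by
  refine Fintype.sum_equiv (e.toEquiv.arrowCongr (Equiv.refl X)) _ _ fun χ => ?_
  have h1 : ∀ u, e.toEquiv.arrowCongr (Equiv.refl X) χ (e u) = χ u := fun u =>
    congrArg χ (e.symm_apply_apply u)
  rw [← arcProd_congr e, ← e.toEquiv.prod_comp]
  congr 1
  · exact Finset.prod_congr rfl fun u _ => congrArg w (h1 u).symm
  · exact congrArg (H.arcProd f) (funext fun u => (h1 u).symm)

end Digraph

namespace SignedTree

/-- A single arc joins the two parts; if it points towards the root, antisymmetry supplies the sign.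
-/
lemma arcProd_att {X : Type} {f : X → X → ℚ} (hf : ∀ x y, f x y = - f y x) (s : ℤˣ) (A B : SignedTree)
    (χ : Vert.{v} A → X) (χ' : Vert.{v} B → X) :
    (toDigraph.{v} (att s A B)).arcProd f (Sum.elim χ χ') =
      (toDigraph A).arcProd f χ * (toDigraph B).arcProd f χ' *
        (1 + (s : ℤ) * f (χ (root A)) (χ' (root B))) := by
  have hsum : ∀ g : Vert.{v} (att s A B) → ℚ,
      ∏ u, g u = (∏ u, g (Sum.inl u)) * ∏ u, g (Sum.inr u) := fun g =>
    Fintype.prod_sum_type (α₁ := Vert A) (α₂ := Vert B) g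
  have h1 : (∏ u : Vert A, ∏ v : Vert B, Digraph.factor (s = 1 ∧ u = root A ∧ v = root B)
      (1 + f (χ u) (χ' v))) = if s = 1 then 1 + f (χ (root A)) (χ' (root B)) else 1 := by
    rw [Finset.prod_eq_single (root A), Finset.prod_eq_single (root B)]
    · simp [Digraph.factor]
    · intro b _ hb; simp [Digraph.factor, hb]
    · simp
    · intro b _ hb; simp [Digraph.factor, hb]
    · simp
  have h2 : (∏ u : Vert B, ∏ v : Vert A, Digraph.factor (s = -1 ∧ v = root A ∧ u = root B)
      (1 + f (χ' u) (χ v))) = if s = -1 then 1 + f (χ' (root B)) (χ (root A)) else 1 := by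
    rw [Finset.prod_eq_single (root B), Finset.prod_eq_single (root A)]
    · simp [Digraph.factor]
    · intro b _ hb; simp [Digraph.factor, hb]
    · simp
    · intro b _ hb; simp [Digraph.factor, hb]
    · simp
  have h3 : (toDigraph.{v} (att s A B)).arcProd f (Sum.elim χ χ') =
      ((toDigraph A).arcProd f χ * (if s = 1 then 1 + f (χ (root A)) (χ' (root B)) else 1)) *
      ((if s = -1 then 1 + f (χ' (root B)) (χ (root A)) else 1) * (toDigraph B).arcProd f χ') := by
    let χ'' : Vert.{v} (att s A B) → X := Sum.elim χ χ'
    refine (hsum fun u => ∏ v, Digraph.factor (Arc (att s A B) u v)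
      (1 + f (χ'' u) (χ'' v))).trans ?_
    rw [← h1, ← h2, Digraph.arcProd, Digraph.arcProd,
      ← Finset.prod_mul_distrib, ← Finset.prod_mul_distrib]
    congr 1
    · exact Finset.prod_congr rfl fun u _ => hsum _
    · exact Finset.prod_congr rfl fun u _ => hsum _
  rw [h3]
  rcases Int.units_eq_one_or s with rfl | rfl
  · simp; ring
  · rw [hf (χ' _)]
    simp; ring

variable {X : Type} [Fintype X]

/-- The homomorphism polynomial of a signed tree. -/
lemma sum_arcProd {f : X → X → ℚ} (hf : ∀ x y, f x y = - f y x) (w : X → ℚ) (t : SignedTree)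
    (g : X → ℚ) :
    ∑ χ : Vert.{v} t → X, g (χ (root t)) * ((∏ u, w (χ u)) * (toDigraph t).arcProd f χ) =
      integral w (g * rooted (op f w) (integral w) t) := by
  induction t generalizing g with
  | pt =>
    rw [integral_apply]
    let e : (Vert.{v} pt → X) ≃ X := Equiv.funUnique PUnit X
    refine Fintype.sum_equiv e _ _ fun χ => ?_
    have h1 : (∏ u : Vert pt, w (χ u)) = w (e χ) :=
      Fintype.prod_unique (ι := PUnit) fun u => w (χ u)
    have h2 : (toDigraph.{v} pt).arcProd f χ = 1 := by
      simp [Digraph.arcProd, Digraph.factor, toDigraph, Arc]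
    have h3 : χ (root pt) = e χ := rfl
    rw [h1, h2, h3, rooted]
    simp [mul_comm]
  | att s A B ihA ihB =>
    have h1 : ∑ χ : Vert.{v} (att s A B) → X, g (χ (root (att s A B))) *
        ((∏ u, w (χ u)) * (toDigraph (att s A B)).arcProd f χ) =
        ∑ χ : (Vert.{v} A → X) × (Vert.{v} B → X), (g (χ.1 (root A)) *
        ((∏ u, w (χ.1 u)) * (toDigraph A).arcProd f χ.1)) *
        ((1 + (s : ℤ) * f (χ.1 (root A)) (χ.2 (root B))) *
          ((∏ u, w (χ.2 u)) * (toDigraph B).arcProd f χ.2)) := by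
      let e : (Vert.{v} A → X) × (Vert.{v} B → X) ≃ (Vert.{v} (att s A B) → X) :=
        (Equiv.sumArrowEquivProdArrow (Vert A) (Vert B) X).symm
      refine (Fintype.sum_equiv e _ _ fun χ => ?_).symm
      have h2 : e χ (root (att s A B)) = χ.1 (root A) := rfl
      have h3 : ∏ u, w (e χ u) = (∏ u, w (χ.1 u)) * ∏ u, w (χ.2 u) :=
        Fintype.prod_sum_type (α₁ := Vert A) (α₂ := Vert B) fun u => w (e χ u)
      have h4 : (toDigraph (att s A B)).arcProd f (e χ) = _ := arcProd_att hf s A B χ.1 χ.2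
      rw [h2, h3, h4]
      ring
    rw [h1, Fintype.sum_prod_type]
    simp only [← Finset.mul_sum]
    have h4 : ∀ x, ∑ χ : Vert.{v} B → X, (1 + (s : ℤ) * f x (χ (root B))) *
        ((∏ u, w (χ u)) * (toDigraph B).arcProd f χ) =
        (algebraMap ℚ (X → ℚ) (integral w (rooted (op f w) (integral w) B)) +
          (s : ℤ) • op f w (rooted (op f w) (integral w) B)) x := by
      intro x
      -- The test function `g` in the statement serves this step: it carries the factor of the
      -- joining edge, which depends on the image of the root of `B`.
      rw [ihB fun y => 1 + (s : ℤ) * f x y]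
      simp only [integral_apply, op_apply, Pi.add_apply, Pi.mul_apply, Pi.intCast_apply,
        Pi.algebraMap_apply, Algebra.algebraMap_self, RingHom.id_apply, zsmul_eq_mul,
        Finset.mul_sum, ← Finset.sum_add_distrib]
      exact Finset.sum_congr rfl fun y _ => by ring
    simp only [h4]
    have h5 := ihA (g * (algebraMap ℚ (X → ℚ) (integral w (rooted (op f w) (integral w) B)) +
          (s : ℤ) • op f w (rooted (op f w) (integral w) B)))
    rw [rooted, mul_comm (rooted _ _ A), ← mul_assoc, ← h5]
    exact Finset.sum_congr rfl fun χ _ => by rw [Pi.mul_apply]; ring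

lemma sum_arcProd_eq_total {f : X → X → ℚ} (hf : ∀ x y, f x y = - f y x) (w : X → ℚ)
    (t : SignedTree) :
    ∑ χ : Vert.{v} t → X, (∏ u, w (χ u)) * (toDigraph t).arcProd f χ =
      total (op f w) (integral w) t := by
  have := sum_arcProd hf w t 1
  simpa [total] using this

end SignedTree

namespace Digraph

/-! ### Injective homomorphisms into tournaments -/

section copies
variable {V W : Type*}

/-- The injective homomorphisms of digraphs. -/
abbrev InjHom (H : Digraph V) (K : Digraph W) : Type _ :=
  {φ : V ↪ W // ∀ u v, H.Adj u v → K.Adj (φ u) (φ v)}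

/-- The copies of `H`, together with an isomorphism from `H`. -/
abbrev MarkedCopy (H : Digraph V) (K : Digraph W) : Type _ :=
  Σ S : {S : K.Subgraph | Nonempty (H.Adj ≃r S.coe.Adj)}, H.Adj ≃r S.1.coe.Adj

variable {H : Digraph V} {K : Digraph W}

/-- The injective homomorphism of a copy. -/
def MarkedCopy.toInjHom (c : MarkedCopy H K) : InjHom H K :=
  ⟨⟨fun u => (c.2 u).1, fun _ _ h => c.2.injective (Subtype.ext h)⟩,
    fun _ _ h => c.1.1.adj_sub (c.2.map_rel_iff.2 h)⟩

/-- An injective homomorphism is an isomorphism onto the subgraph formed by the images of its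
vertices and arcs. -/
lemma MarkedCopy.toInjHom_bijective :
    Function.Bijective (MarkedCopy.toInjHom : MarkedCopy H K → InjHom H K) := by
  constructor
  · rintro ⟨⟨S, hS⟩, e⟩ ⟨⟨S', hS'⟩, e'⟩ h
    have h1 : ∀ u, (e u).1 = (e' u).1 := fun u => DFunLike.congr_fun (congrArg Subtype.val h) u
    have hverts : ∀ {S : K.Subgraph} (e : H.Adj ≃r S.coe.Adj) (x : W),
        x ∈ S.verts ↔ ∃ u, (e u).1 = x := by
      intro S e x
      constructor
      · intro hx
        obtain ⟨u, hu⟩ := e.surjective ⟨x, hx⟩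
        exact ⟨u, congrArg Subtype.val hu⟩
      · rintro ⟨u, rfl⟩
        exact (e u).2
    have hadj : ∀ {S : K.Subgraph} (e : H.Adj ≃r S.coe.Adj) (x y : W),
        S.Adj x y ↔ ∃ u v, H.Adj u v ∧ (e u).1 = x ∧ (e v).1 = y := by
      intro S e x y
      constructor
      · intro h
        obtain ⟨u, hu⟩ := (hverts e x).1 (S.left_mem h)
        obtain ⟨v, hv⟩ := (hverts e y).1 (S.right_mem h)
        refine ⟨u, v, e.map_rel_iff.1 ?_, hu, hv⟩
        change S.Adj (e u) (e v)
        rwa [hu, hv]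
      · rintro ⟨u, v, h, rfl, rfl⟩
        exact e.map_rel_iff.2 h
    have hSS : S = S' := by
      ext x y
      · rw [hverts e, hverts e']
        simp only [h1]
      · rw [hadj e, hadj e']
        simp only [h1]
    subst hSS
    have hee : e = e' := RelIso.ext fun u => Subtype.ext (h1 u)
    rw [hee]
  · rintro ⟨φ, hφ⟩
    let S : K.Subgraph :=
      { verts := Set.range φ
        Adj := fun x y => ∃ u v, H.Adj u v ∧ φ u = x ∧ φ v = y
        adj_sub := by rintro _ _ ⟨u, v, h, rfl, rfl⟩; exact hφ u v h
        left_mem := by rintro _ _ ⟨u, v, h, rfl, rfl⟩; exact ⟨u, rfl⟩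
        right_mem := by rintro _ _ ⟨u, v, h, rfl, rfl⟩; exact ⟨v, rfl⟩ }
    let e : H.Adj ≃r S.coe.Adj :=
      { toEquiv := Equiv.ofInjective φ φ.injective
        map_rel_iff' := by
          intro a b
          constructor
          · rintro ⟨u, v, h, hu, hv⟩
            rwa [← φ.injective hu, ← φ.injective hv]
          · exact fun h => ⟨a, b, h, rfl, rfl⟩ }
    exact ⟨⟨⟨S, ⟨e⟩⟩, e⟩, rfl⟩

/-- The injective homomorphisms are counted by the copies. -/
lemma card_injHom (H : Digraph V) (K : Digraph W) :
    Nat.card (InjHom H K) = H.copyCount K * Nat.card (H.Adj ≃r H.Adj) := by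
  rw [← Nat.card_congr (Equiv.ofBijective _ MarkedCopy.toInjHom_bijective), copyCount,
    ← Nat.card_coe_set_eq, ← Nat.card_prod]
  refine Nat.card_congr ((Equiv.sigmaCongrRight fun S => ?_).trans (Equiv.sigmaEquivProd _ _))
  let e₀ := S.2.some
  exact
    { toFun := fun e => e.trans e₀.symm
      invFun := fun e => e.trans e₀
      left_inv := fun e => by ext; simp
      right_inv := fun e => by ext; simp }

end copies

/-! ### From tournaments to weighted antisymmetric matrices -/

section arcProd
variable {V : Type*} [Fintype V]

lemma arcProd_eq_prod {X R : Type*} [CommRing R] (H : Digraph V) (f : X → X → R) (χ : V → X) :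
    H.arcProd f χ = ∏ p : V × V, factor (H.Adj p.1 p.2) (1 + f (χ p.1) (χ p.2)) :=
  (Fintype.prod_prod_type' _).symm

/-- The number of arcs. -/
noncomputable def arcCount (H : Digraph V) : ℕ := Nat.card {p : V × V // H.Adj p.1 p.2}

open Classical in
lemma arcProd_of_sign (H : Digraph V) {X : Type*} (f : X → X → ℚ) (χ : V → X)
    (h : ∀ u v, H.Adj u v → f (χ u) (χ v) = 1 ∨ f (χ u) (χ v) = -1) :
    H.arcProd f χ =
      if ∀ u v, H.Adj u v → f (χ u) (χ v) = 1 then 2 ^ H.arcCount else 0 := by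
  rw [arcProd_eq_prod]
  split_ifs with h1
  · have h2 : ∀ p : V × V, factor (H.Adj p.1 p.2) (1 + f (χ p.1) (χ p.2)) =
        if H.Adj p.1 p.2 then 2 else 1 := by
      intro p
      rw [factor]
      split_ifs with h3
      · rw [h1 _ _ h3]; norm_num
      · rfl
    rw [Finset.prod_congr rfl fun p _ => h2 p, Finset.prod_ite, Finset.prod_const,
      Finset.prod_const_one, mul_one, arcCount, Nat.card_eq_fintype_card, Fintype.card_subtype]
  · push Not at h1
    obtain ⟨u, v, h2, h3⟩ := h1
    refine Finset.prod_eq_zero (Finset.mem_univ (u, v)) ?_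
    rw [factor, if_pos h2, (h u v h2).resolve_left h3]
    norm_num

/-- The matrix `x` with new entries at `(i, j)` and `(j, i)`. -/
def setEntry {I : Type*} [DecidableEq I] (x : I → I → ℚ) (i j : I) (a : ℚ) : I → I → ℚ :=
  fun k l => if (k, l) = (i, j) then a else if (k, l) = (j, i) then -a else x k l

lemma setEntry_neg {I : Type*} [DecidableEq I] {x : I → I → ℚ} (hx : ∀ k l, x k l = - x l k)
    {i j : I} (hij : i ≠ j) (a : ℚ) (k l : I) :
    setEntry x i j a k l = - setEntry x i j a l k := by
  have := hx k l
  simp only [setEntry, Prod.mk.injEq]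
  by_cases h1 : k = i ∧ l = j
  · obtain ⟨rfl, rfl⟩ := h1
    simp [hij.symm]
  · by_cases h2 : k = j ∧ l = i
    · obtain ⟨rfl, rfl⟩ := h2
      simp [hij.symm]
    · rw [if_neg h1, if_neg h2, if_neg (fun h => h2 h.symm), if_neg (fun h => h1 h.symm), this]

/-- As `φ` is injective and `H` oriented, at most one arc uses the entries at `(i, j)` and `(j, i)`.
The product is therefore affine in `a` and interpolated from `a = 1` and `a = -1`. -/
lemma arcProd_setEntry {I : Type*} [DecidableEq I] {H : Digraph V} (ho : H.IsOriented)
    (x : I → I → ℚ) {i j : I} (hij : i ≠ j) (φ : V ↪ I) (a : ℚ) :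
    H.arcProd (setEntry x i j a) φ = (1 + a) / 2 * H.arcProd (setEntry x i j 1) φ +
      (1 - a) / 2 * H.arcProd (setEntry x i j (-1)) φ := by
  classical
  by_cases h : ∃ u v, φ u = i ∧ φ v = j
  · obtain ⟨u, v, rfl, rfl⟩ := h
    have huv : u ≠ v := fun h => hij (congrArg φ h)
    have key : ∀ a, H.arcProd (setEntry x (φ u) (φ v) a) φ =
        factor (H.Adj u v) (1 + a) * factor (H.Adj v u) (1 - a) *
          ∏ p : V × V, if p = (u, v) ∨ p = (v, u) then 1
            else factor (H.Adj p.1 p.2) (1 + x (φ p.1) (φ p.2)) := by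
      intro a
      have h1 : factor (H.Adj u v) (1 + a) =
          ∏ p : V × V, if p = (u, v) then factor (H.Adj u v) (1 + a) else 1 := by simp
      have h2 : factor (H.Adj v u) (1 - a) =
          ∏ p : V × V, if p = (v, u) then factor (H.Adj v u) (1 - a) else 1 := by simp
      rw [h1, h2, ← Finset.prod_mul_distrib, ← Finset.prod_mul_distrib, arcProd_eq_prod]
      refine Finset.prod_congr rfl fun p _ => ?_
      obtain ⟨k, l⟩ := p
      simp only [setEntry, Prod.mk.injEq, φ.injective.eq_iff]
      by_cases h1 : k = u ∧ l = v
      · obtain ⟨rfl, rfl⟩ := h1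
        simp [huv]
      · by_cases h2 : k = v ∧ l = u
        · obtain ⟨rfl, rfl⟩ := h2
          simp [huv.symm, sub_eq_add_neg]
        · simp [h1, h2]
    rw [key, key 1, key (-1)]
    have h1 := ho u v
    by_cases h2 : H.Adj u v
    · simp only [factor, if_pos h2, if_neg (h1 h2)]
      ring
    · by_cases h3 : H.Adj v u
      · simp only [factor, if_neg h2, if_pos h3]
        ring
      · simp only [factor, if_neg h2, if_neg h3]
        ring
  · have key : ∀ a, H.arcProd (setEntry x i j a) φ = H.arcProd x φ := by
      intro a
      rw [arcProd_eq_prod, arcProd_eq_prod]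
      refine Finset.prod_congr rfl fun p _ => ?_
      rw [setEntry, if_neg, if_neg]
      · intro he
        exact h ⟨p.2, p.1, (Prod.mk.injEq _ _ _ _ ▸ he).2, (Prod.mk.injEq _ _ _ _ ▸ he).1⟩
      · intro he
        exact h ⟨p.1, p.2, (Prod.mk.injEq _ _ _ _ ▸ he).1, (Prod.mk.injEq _ _ _ _ ▸ he).2⟩
    rw [key, key, key]
    ring

/-- If the sum over all injections is constant on sign matrices, then it is constant on
antisymmetric matrices. -/
lemma sum_arcProd_eq_of_sign {H : Digraph V} (ho : H.IsOriented) {n : ℕ} {c : ℚ}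
    (hc : ∀ x : Fin n → Fin n → ℚ, (∀ i j, x i j = - x j i) →
      (∀ i j, i < j → x i j = 1 ∨ x i j = -1) → ∑ φ : V ↪ Fin n, H.arcProd x φ = c)
    (x : Fin n → Fin n → ℚ) (hx : ∀ i j, x i j = - x j i) :
    ∑ φ : V ↪ Fin n, H.arcProd x φ = c := by
  have key : ∀ (P : Finset (Fin n × Fin n)) (x : Fin n → Fin n → ℚ), (∀ i j, x i j = - x j i) →
      (∀ i j, i < j → (i, j) ∉ P → x i j = 1 ∨ x i j = -1) →
        ∑ φ : V ↪ Fin n, H.arcProd x φ = c := by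
    -- `P` contains the entries not yet known to be signs; they are replaced by signs one at a time.
    intro P
    induction P using Finset.induction with
    | empty => exact fun x hx h => hc x hx fun i j hij => h i j hij (Finset.notMem_empty _)
    | insert p P _ ih =>
      obtain ⟨i, j⟩ := p
      intro x hx h
      by_cases hij : i < j
      · have hset : x = setEntry x i j (x i j) := by
          funext k l
          simp only [setEntry, Prod.mk.injEq]
          split_ifs with h1 h2
          · rw [h1.1, h1.2]
          · rw [h2.1, h2.2, hx j i]
          · rfl
        have hsign : ∀ a : ℚ, (a = 1 ∨ a = -1) →
            ∑ φ : V ↪ Fin n, H.arcProd (setEntry x i j a) φ = c := by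
          intro a ha
          refine ih _ (setEntry_neg hx hij.ne a) fun k l hkl hP => ?_
          simp only [setEntry, Prod.mk.injEq]
          split_ifs with h1 h2
          · exact ha
          · rcases ha with rfl | rfl <;> simp
          · exact h k l hkl (by simp [h1, hP])
        rw [hset, Finset.sum_congr rfl fun φ _ => arcProd_setEntry ho x hij.ne φ (x i j),
          Finset.sum_add_distrib, ← Finset.mul_sum, ← Finset.mul_sum, hsign 1 (Or.inl rfl),
          hsign (-1) (Or.inr rfl)]
        ring
      · refine ih x hx fun k l hkl hP => h k l hkl ?_
        rw [Finset.mem_insert]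
        rintro (h1 | h1)
        · obtain ⟨rfl, rfl⟩ := Prod.mk.injEq _ _ _ _ ▸ h1
          exact hij hkl
        · exact hP h1
  exact key Finset.univ x hx fun i j _ h => absurd (Finset.mem_univ _) h

/-- The sum over all injections of an impartial digraph does not depend on the matrix. -/
lemma IsImpartial.exists_sum_arcProd_eq {H : Digraph V} (ho : H.IsOriented) (hi : H.IsImpartial) :
    ∃ n, Fintype.card V ≤ n ∧ ∀ x : Fin n → Fin n → ℚ, (∀ i j, x i j = - x j i) →
      ∑ φ : V ↪ Fin n, H.arcProd x φ = Fintype.card (V ↪ Fin n) := by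
  classical
  obtain ⟨n, hn, h⟩ := hi
  refine ⟨n, hn, ?_⟩
  let K (x : Fin n → Fin n → ℚ) : Digraph (Fin n) := ⟨fun i j => x i j = 1⟩
  have hK : ∀ x : Fin n → Fin n → ℚ, (∀ i j, x i j = - x j i) →
      (∀ i j, i < j → x i j = 1 ∨ x i j = -1) →
        (K x).IsTournament ∧ ∑ φ : V ↪ Fin n, H.arcProd x φ =
          2 ^ H.arcCount * (H.copyCount (K x) * Nat.card (H.Adj ≃r H.Adj) : ℕ) := by
    intro x hx hs
    have hs' : ∀ i j, i ≠ j → x i j = 1 ∨ x i j = -1 := by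
      intro i j hij
      rcases lt_or_gt_of_ne hij with h | h
      · exact hs i j h
      · rw [hx]
        rcases hs j i h with h | h <;> simp [h]
    refine ⟨⟨fun i hi => ?_, fun i j hij => ?_⟩, ?_⟩
    · have h1 := hx i i
      have h2 : x i i = 1 := hi
      rw [h2] at h1
      norm_num at h1
    · change x i j = 1 ↔ ¬ x j i = 1
      rw [hx j i]
      rcases hs' i j hij with h | h <;> rw [h] <;> norm_num
    · have h1 : ∀ φ : V ↪ Fin n, H.arcProd x φ =
          if ∀ u v, H.Adj u v → (K x).Adj (φ u) (φ v) then 2 ^ H.arcCount else 0 := by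
        intro φ
        refine (arcProd_of_sign H x φ fun u v huv => hs' _ _ ?_).trans ?_
        · intro he
          rw [φ.injective he] at huv
          exact ho _ _ huv huv
        · congr
      rw [Finset.sum_congr rfl fun φ _ => h1 φ, ← Finset.sum_filter, Finset.sum_const,
        ← card_injHom, Nat.card_eq_fintype_card, Fintype.card_subtype, nsmul_eq_mul, mul_comm]
  let x₀ : Fin n → Fin n → ℚ := fun i j => if i < j then 1 else if j < i then -1 else 0
  have hx₀ : ∀ i j, x₀ i j = - x₀ j i := by
    intro i j
    rcases lt_trichotomy i j with h | rfl | h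
    · simp [x₀, h, h.not_gt]
    · simp [x₀]
    · simp [x₀, h, h.not_gt]
  have hs₀ : ∀ i j, i < j → x₀ i j = 1 ∨ x₀ i j = -1 := fun i j h => by simp [x₀, h]
  have h1 := sum_arcProd_eq_of_sign ho (n := n)
    (c := 2 ^ H.arcCount * (H.copyCount (K x₀) * Nat.card (H.Adj ≃r H.Adj) : ℕ))
    fun x hx hs => by
      rw [(hK x hx hs).2, h _ _ (hK x hx hs).1 (hK x₀ hx₀ hs₀).1]
  intro x hx
  -- At the zero matrix every injection contributes `1`, which evaluates the constant.
  rw [h1 x hx, ← h1 (fun _ _ => 0) (by simp)]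
  simp [arcProd, factor]

/-- Summation over the values outside of the image of an injection. -/
lemma sum_comp_embedding {I X : Type*} [Fintype I] [DecidableEq I] [DecidableEq V] [Fintype X]
    (w : X → ℚ) (g : (V → X) → ℚ) (φ : V ↪ I) :
    ∑ ψ : I → X, (∏ i, w (ψ i)) * g (ψ ∘ φ) =
      (∑ χ : V → X, (∏ v, w (χ v)) * g χ) *
        (∑ x, w x) ^ (Fintype.card I - Fintype.card V) := by
  classical
  let J := {i // i ∉ Set.range φ}
  let e : V ⊕ J ≃ I := ((Equiv.ofInjective φ φ.injective).sumCongr (Equiv.refl J)).trans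
    (Equiv.Set.sumCompl (Set.range φ))
  have hcard : Fintype.card J = Fintype.card I - Fintype.card V := by
    have := Fintype.card_congr e
    rw [Fintype.card_sum] at this
    omega
  let E : (V → X) × (J → X) ≃ (I → X) :=
    (Equiv.sumArrowEquivProdArrow V J X).symm.trans (e.arrowCongr (Equiv.refl X))
  have hE : ∀ χ s, E χ (e s) = Sum.elim χ.1 χ.2 s := by
    intro χ s
    simp [E, Equiv.sumArrowEquivProdArrow]
  have hpow : (∑ x, w x) ^ Fintype.card J = ∑ χ : J → X, ∏ j, w (χ j) := by
    rw [← Finset.card_univ, ← Finset.prod_const, Finset.prod_univ_sum]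
    simp
  rw [← hcard, hpow, Finset.sum_mul_sum, ← Finset.sum_product', ← E.sum_comp]
  refine Finset.sum_congr rfl fun χ _ => ?_
  have h1 : E χ ∘ φ = χ.1 := by
    funext v
    exact hE χ (Sum.inl v)
  rw [h1, ← e.prod_comp]
  simp only [hE, Fintype.prod_sum_type, Sum.elim_inl, Sum.elim_inr]
  ring

lemma sum_prod_eq_pow {X : Type*} [Fintype X] [DecidableEq V] (w : X → ℚ) :
    ∑ χ : V → X, ∏ v, w (χ v) = (∑ x, w x) ^ Fintype.card V := by
  rw [← Finset.card_univ, ← Finset.prod_const, Finset.prod_univ_sum]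
  simp

/-- The homomorphism polynomials of an impartial digraph are those of independent vertices. -/
lemma IsImpartial.exists_pow_mul_eq [DecidableEq V] {H : Digraph V} (ho : H.IsOriented)
    (hi : H.IsImpartial) : ∃ m : ℕ, ∀ (X : Type) [Fintype X] (f : X → X → ℚ) (w : X → ℚ),
      (∀ x y, f x y = - f y x) → (∑ x, w x) ^ m * (∑ χ : V → X, (∏ v, w (χ v)) * H.arcProd f χ) =
        (∑ x, w x) ^ (m + Fintype.card V) := by
  obtain ⟨n, hn, h⟩ := hi.exists_sum_arcProd_eq ho
  refine ⟨n - Fintype.card V, fun X _ f w hf => ?_⟩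
  -- Pull `f` back along `ψ` and sum over `ψ`: every injection contributes the same homomorphism
  -- polynomial, and the points outside its image a power of `∑ x, w x`.
  have h1 : ∑ ψ : Fin n → X, (∏ i, w (ψ i)) *
      ∑ φ : V ↪ Fin n, H.arcProd (fun i j => f (ψ i) (ψ j)) φ =
        (Fintype.card (V ↪ Fin n) : ℚ) * ((∑ x, w x) ^ (n - Fintype.card V) *
          ∑ χ : V → X, (∏ v, w (χ v)) * H.arcProd f χ) := by
    simp only [Finset.mul_sum]
    rw [Finset.sum_comm]
    have h2 : ∀ φ : V ↪ Fin n, ∑ ψ : Fin n → X, (∏ i, w (ψ i)) *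
        H.arcProd (fun i j => f (ψ i) (ψ j)) φ =
          (∑ x, w x) ^ (n - Fintype.card V) *
            ∑ χ : V → X, (∏ v, w (χ v)) * H.arcProd f χ := by
      intro φ
      have := sum_comp_embedding w (fun χ => H.arcProd f χ) φ
      rw [Fintype.card_fin] at this
      rw [mul_comm _ (∑ χ : V → X, _), ← this]
      rfl
    rw [Finset.sum_congr rfl fun φ _ => h2 φ, Finset.sum_const, Finset.card_univ, nsmul_eq_mul]
    simp only [Finset.mul_sum]
  rw [Finset.sum_congr rfl fun ψ _ => by rw [h _ fun i j => hf (ψ i) (ψ j)], ← Finset.sum_mul,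
    sum_prod_eq_pow, Fintype.card_fin, mul_comm] at h1
  have hpos : (Fintype.card (V ↪ Fin n) : ℚ) ≠ 0 := by
    rw [Nat.cast_ne_zero, Fintype.card_embedding_eq, Fintype.card_fin]
    exact (Nat.descFactorial_pos.2 hn).ne'
  rw [← mul_left_cancel₀ hpos h1, Nat.sub_add_cancel hn]

end arcProd

end Digraph

/-! ### Impartiality forces a tree -/

namespace Digraph

section tree
variable {V : Type*} [Fintype V]

/-- If the homomorphism polynomials of a digraph are those of independent vertices, then the number
of its arcs is limited by the powers of two in the number of bijections. -/
lemma two_pow_arcCount_dvd [DecidableEq V] {H : Digraph V} (ho : H.IsOriented) [Nonempty V] {m : ℕ}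
    (h : ∀ (X : Type) [Fintype X] (f : X → X → ℚ) (w : X → ℚ),
      (∀ x y, f x y = - f y x) → (∑ x, w x) ^ m * (∑ χ : V → X, (∏ v, w (χ v)) * H.arcProd f χ) =
        (∑ x, w x) ^ (m + Fintype.card V)) :
    2 ^ H.arcCount ∣ (Fintype.card V).factorial := by
  classical
  set d := Fintype.card V with hd
  have hdpos : 0 < d := Fintype.card_pos
  let f : Fin d → Fin d → ℚ := fun i j => if i < j then 1 else if j < i then -1 else 0
  have hf : ∀ i j, f i j = - f j i := by
    intro i j
    rcases lt_trichotomy i j with h | rfl | h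
    · simp [f, h, h.not_gt]
    · simp [f]
    · simp [f, h, h.not_gt]
  have hfs : ∀ i j, i ≠ j → f i j = 1 ∨ f i j = -1 := by
    intro i j hij
    rcases lt_or_gt_of_ne hij with h | h
    · simp [f, h]
    · simp [f, h, h.not_gt]
  let mon (χ : V → Fin d) : MvPolynomial (Fin d) ℚ := ∏ v, MvPolynomial.X (χ v)
  let S : MvPolynomial (Fin d) ℚ := ∑ i, MvPolynomial.X i
  let p : MvPolynomial (Fin d) ℚ := ∑ χ : V → Fin d, MvPolynomial.C (H.arcProd f χ) * mon χ
  let q : MvPolynomial (Fin d) ℚ := ∑ χ : V → Fin d, mon χ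
  have hS : S ≠ 0 := by
    intro h0
    have := congrArg (MvPolynomial.eval fun _ => (1 : ℚ)) h0
    simp [S, hdpos.ne'] at this
  have hmon : ∀ w χ, MvPolynomial.eval w (mon χ) = ∏ v, w (χ v) := by
    intro w χ; simp [mon]
  have hpq : S ^ m * p = S ^ m * q := by
    apply MvPolynomial.funext
    intro w
    have h1 := h (Fin d) f w hf
    rw [pow_add, ← sum_prod_eq_pow (V := V)] at h1
    simp only [S, p, q, map_mul, map_pow, map_sum, MvPolynomial.eval_X, MvPolynomial.eval_C, hmon]
    rw [← h1]
    simp only [mul_comm]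
  have hpq' : p = q := mul_left_cancel₀ (pow_ne_zero _ hS) hpq
  -- The squarefree monomial in all variables picks out the bijections: each contributes `2 ^
  -- H.arcCount` or `0` to `p`, and `1` to `q`.
  let e : Fin d →₀ ℕ := ∑ i, Finsupp.single i 1
  have hcoeff : ∀ χ, (mon χ).coeff e = if Function.Injective χ then 1 else 0 := by
    intro χ
    have h1 : mon χ = MvPolynomial.monomial (∑ v, Finsupp.single (χ v) 1) 1 := by
      rw [MvPolynomial.monomial_sum_one]
      rfl
    rw [h1, MvPolynomial.coeff_monomial]
    refine if_congr ?_ rfl rfl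
    constructor
    · intro he
      have hsurj : Function.Surjective χ := by
        intro i
        by_contra! hi
        have := DFunLike.congr_fun he i
        rw [Finsupp.finsetSum_apply, Finsupp.finsetSum_apply,
          Finset.sum_eq_zero fun v _ => Finsupp.single_eq_of_ne (hi v).symm] at this
        simp [Finsupp.single_apply] at this
      exact ((Fintype.bijective_iff_surjective_and_card χ).2 ⟨hsurj, by simp [hd]⟩).injective
    · intro hi
      have hb := (Fintype.bijective_iff_injective_and_card χ).2 ⟨hi, by simp [hd]⟩
      exact hb.sum_comp fun i => Finsupp.single i 1
  have hcount := congrArg (MvPolynomial.coeff e) hpq'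
  simp only [p, q, MvPolynomial.coeff_sum, MvPolynomial.coeff_C_mul, hcoeff] at hcount
  have h1 : ∀ χ : V → Fin d, (H.arcProd f χ * if Function.Injective χ then 1 else 0) =
      if Function.Injective χ ∧ ∀ u v, H.Adj u v → f (χ u) (χ v) = 1 then
        2 ^ H.arcCount else 0 := by
    intro χ
    by_cases hi : Function.Injective χ
    · rw [arcProd_of_sign H f χ fun u v huv => hfs _ _ fun he => by
        rw [hi he] at huv; exact ho _ _ huv huv]
      simp [hi]
    · simp [hi]
  rw [Finset.sum_congr rfl fun χ _ => h1 χ, ← Finset.sum_filter, Finset.sum_const,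
    ← Finset.sum_filter, Finset.sum_const, nsmul_eq_mul, nsmul_eq_mul, mul_one] at hcount
  have h2 : (Finset.univ.filter fun χ : V → Fin d => Function.Injective χ).card = d.factorial := by
    rw [← Fintype.card_subtype, Fintype.card_congr (Equiv.subtypeInjectiveEquivEmbedding V (Fin d)),
      Fintype.card_embedding_eq, Fintype.card_fin, ← hd, Nat.descFactorial_self]
  rw [h2] at hcount
  norm_cast at hcount
  exact Dvd.intro_left _ hcount

/-- A connected oriented graph with fewer arcs than vertices is a tree. -/
lemma isTree_of_arcCount_lt {H : Digraph V} (hconn : H.WeaklyConnected)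
    (h : H.arcCount < Fintype.card V) : H.toSimpleGraphInclusive.IsTree := by
  rw [SimpleGraph.isTree_iff_connected_and_card]
  refine ⟨hconn, le_antisymm ?_ hconn.card_vert_le_card_edgeSet_add_one⟩
  rw [Nat.card_eq_fintype_card (α := V)]
  refine lt_of_le_of_lt ?_ h
  let g : {p : V × V // H.Adj p.1 p.2 ∧ p.1 ≠ p.2} → H.toSimpleGraphInclusive.edgeSet :=
    fun p => ⟨s(p.1.1, p.1.2), p.2.2, Or.inl p.2.1⟩
  have hg : Function.Surjective g := by
    rintro ⟨e, he⟩
    induction e using Sym2.ind with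
    | _ u v =>
      rcases he with ⟨hne, h | h⟩
      · exact ⟨⟨(u, v), h, hne⟩, rfl⟩
      · exact ⟨⟨(v, u), h, hne.symm⟩, Subtype.ext Sym2.eq_swap⟩
  refine (Nat.card_le_card_of_surjective g hg).trans ?_
  exact Nat.card_le_card_of_injective (fun p => ⟨p.1, p.2.1⟩) fun p p' h =>
    Subtype.ext (Subtype.mk.inj h)

end tree

end Digraph

theorem proposition5p1 {V : Type*} [Fintype V] (H : Digraph V) (horiented : H.IsOriented)
    (hconn : H.WeaklyConnected) (himp : H.IsImpartial) :
    H.RecursivelyBridgeMirrored := by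
  classical
  obtain ⟨m, hm⟩ := himp.exists_pow_mul_eq horiented
  have : Nonempty V := hconn.nonempty
  have hlt : H.arcCount < Fintype.card V := by
    have h1 := pow_dvd_iff_le_emultiplicity.1 (Digraph.two_pow_arcCount_dvd horiented hm)
    -- The exponent of two in `d!` is less than `d` for `d ≠ 0`.
    exact_mod_cast h1.trans_lt (Nat.emultiplicity_two_factorial_lt Fintype.card_ne_zero)
  obtain ⟨r⟩ := this
  obtain ⟨t, e, -⟩ := exists_iso_of_isTree _ rfl H horiented
    (Digraph.isTree_of_arcCount_lt hconn hlt) r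
  refine .iso _ _ (Mirrored.recursivelyBridgeMirrored ?_) ⟨e⟩
  have huniv : formalTotal universalWeight t = universalWeight 1 ^ Fintype.card V := by
    apply formalTotal_eq_of_density (m := m)
    intro X _ f w hf
    rw [← hm X f w hf, ← sum_arcProd_eq_total hf w t]
    exact congrArg _ (Digraph.sum_arcProd_congr (H := toDigraph t) e f w)
  exact mirrored_of_testTotal_eq_one fun N _ _ => testTotal_eq_one_of_universal ℤ huniv
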